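/- Let $(R,\mathfrak m)$ be a commutative noetherian local ring with $\mathfrak m$-adic completion $\widehat R$, let $m$ be a positive integer, and let $P$ be a complex of finite rank free $\widehat R$-modules (graded homologically) such that $P_n=0$ when $n<0$ or $n>m$. Let $\boldsymbol a=a_1,\dots,a_e$ be a finite sequence of elements of $\mathfrak m$ that is co-complete, i.e. the local ring $R/(\boldsymbol a)$ is complete with respect to its maximal ideal. Let $K^{\widehat R}$ be the Koszul complex over $\widehat R$ on the images of $a_1,\dots,a_e$ in $\widehat R$, regarded as a DG algebra via the exterior product, and let $\mathsf D(K^{\widehat R})$ be the derived category of DG $K^{\widehat R}$-modules (the localization of the category of DG $K^{\widehat R}$-modules at the quasiisomorphisms). Then there exists a finite system $\mathcal S$ of polynomial equations, in finitely many variables and with coefficients in $R$, such that: (a) the system $\mathcal S$ has a solution in $\widehat R$; (b) for every solution to $\mathcal S$ in $R$ there is a complex $A$ of finite rank free $R$-modules with $A_n=0$ when $n<0$ or $n>m$, and with $$K^{\widehat R}\otimes_R A\;\simeq\;K^{\widehat R}\otimes_{\widehat R}P\quad\text{in } \mathsf D(K^{\widehat R}),$$ where $K^{\widehat R}$ acts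 on both sides by multiplication on the left tensor factor. -/

import Mathlib

open CategoryTheory
open scoped TensorProduct DirectSum

universe u

/-! ### The Koszul complex as a DG algebra -/

/-- The graded algebra underlying the Koszul complex on a sequence of length `e` in `S`:
the exterior algebra of `S ^ e`.  Its degree `i` component is `⋀[S]^i (Fin e → S)`. -/
abbrev KoszulAlgebra (S : Type u) [CommRing S] (e : ℕ) : Type u :=
  ExteriorAlgebra S (Fin e → S)

/-- The linear functional `S ^ e → S` sending the `i`-th standard basis vector to `b i`. -/
noncomputable def koszulFunctional {S : Type u} [CommRing S] {e : ℕ} (b : Fin e → S) :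
    Module.Dual S (Fin e → S) :=
  Fintype.linearCombination S b

/-- The Koszul differential on the sequence `b`: contraction with `koszulFunctional b`, i.e. the
unique `S`-linear map with `∂ 1 = 0` and `∂ (v ∧ x) = (∑ vᵢ bᵢ) x - v ∧ ∂ x` for `v` of degree one
(see `koszulD_ι_mul`). -/
noncomputable def koszulD {S : Type u} [CommRing S] {e : ℕ} (b : Fin e → S) :
    KoszulAlgebra S e →ₗ[S] KoszulAlgebra S e :=
  CliffordAlgebra.contractLeft (Q := (0 : QuadraticForm S (Fin e → S))) (koszulFunctional b)

section Koszul

variable {S : Type u} [CommRing S] {e : ℕ} (b : Fin e → S)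

theorem koszulD_one : koszulD b 1 = 0 :=
  CliffordAlgebra.contractLeft_one (Q := (0 : QuadraticForm S (Fin e → S))) (koszulFunctional b)

theorem koszulD_algebraMap (s : S) : koszulD b (algebraMap S _ s) = 0 :=
  CliffordAlgebra.contractLeft_algebraMap (Q := (0 : QuadraticForm S (Fin e → S)))
    (koszulFunctional b) s

theorem koszulD_ι_mul (v : Fin e → S) (x : KoszulAlgebra S e) :
    koszulD b (ExteriorAlgebra.ι S v * x) =
      (∑ i, v i * b i) • x - ExteriorAlgebra.ι S v * koszulD b x := by
  have h := CliffordAlgebra.contractLeft_ι_mul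
    (Q := (0 : QuadraticForm S (Fin e → S))) (koszulFunctional b) v x
  have h' : koszulFunctional b v = ∑ i, v i * b i := by
    simp [koszulFunctional, Fintype.linearCombination_apply]
  rw [h'] at h
  exact h

theorem koszulD_koszulD (x : KoszulAlgebra S e) : koszulD b (koszulD b x) = 0 :=
  CliffordAlgebra.contractLeft_contractLeft _ _

/-- The `S`-linear map that is multiplication by `(-1) ^ i` on the degree `i` component of the
Koszul algebra (see `koszulSign_of_mem`). -/
noncomputable def koszulSign (S : Type u) [CommRing S] (e : ℕ) :
    KoszulAlgebra S e →ₗ[S] KoszulAlgebra S e :=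
  (CliffordAlgebra.involute (Q := (0 : QuadraticForm S (Fin e → S)))).toLinearMap

theorem koszulSign_mul (x y : KoszulAlgebra S e) :
    koszulSign S e (x * y) = koszulSign S e x * koszulSign S e y :=
  map_mul (CliffordAlgebra.involute (Q := (0 : QuadraticForm S (Fin e → S)))) x y

theorem koszulSign_algebraMap (s : S) :
    koszulSign S e (algebraMap S _ s) = algebraMap S _ s :=
  AlgHom.commutes (CliffordAlgebra.involute (Q := (0 : QuadraticForm S (Fin e → S)))) s

theorem koszulSign_ι (v : Fin e → S) :
    koszulSign S e (ExteriorAlgebra.ι S v) = -ExteriorAlgebra.ι S v :=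
  CliffordAlgebra.involute_ι (Q := (0 : QuadraticForm S (Fin e → S))) v

theorem koszulSign_of_mem {i : ℕ} {x : KoszulAlgebra S e} (hx : x ∈ ⋀[S]^i (Fin e → S)) :
    koszulSign S e x = (-1 : ℤ) ^ i • x := by
  induction hx using Submodule.pow_induction_on_left' with
  | algebraMap r => simp [koszulSign_algebraMap]
  | add x y i _ _ hx hy => rw [map_add, hx, hy, smul_add]
  | mem_mul m hm i x _ ih =>
    obtain ⟨v, rfl⟩ := hm
    rw [koszulSign_mul, koszulSign_ι, ih, pow_succ', neg_mul, mul_smul_comm, mul_smul,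
      neg_one_smul]

theorem koszulD_mul (x y : KoszulAlgebra S e) :
    koszulD b (x * y) = koszulD b x * y + koszulSign S e x * koszulD b y := by
  induction x using CliffordAlgebra.left_induction with
  | algebraMap r =>
    have h1 : koszulD b (algebraMap S (KoszulAlgebra S e) r) = 0 := koszulD_algebraMap b r
    have h2 : koszulSign S e (algebraMap S (KoszulAlgebra S e) r) = algebraMap S _ r :=
      koszulSign_algebraMap r
    erw [h1, h2]
    rw [← Algebra.smul_def, ← Algebra.smul_def, map_smul, zero_mul, zero_add]
  | add x x' hx hx' => rw [add_mul, map_add, map_add, map_add, hx, hx']; noncomm_ring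
  | ι_mul x v hx =>
    have key : ∀ z, koszulD b (ExteriorAlgebra.ι S v * z) = _ := koszulD_ι_mul b v
    change koszulD b (ExteriorAlgebra.ι S v * x * y) =
      koszulD b (ExteriorAlgebra.ι S v * x) * y +
        koszulSign S e (ExteriorAlgebra.ι S v * x) * koszulD b y
    rw [mul_assoc, key, key, hx, koszulSign_mul, koszulSign_ι, sub_mul, smul_mul_assoc, mul_add]
    noncomm_ring

/-- The Koszul differential lowers the degree by one (and vanishes in degree `0`). -/
theorem koszulD_mem {i : ℕ} {x : KoszulAlgebra S e} (hx : x ∈ ⋀[S]^i (Fin e → S)) :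
    koszulD b x = 0 ∨ ∃ j, i = j + 1 ∧ koszulD b x ∈ ⋀[S]^j (Fin e → S) := by
  suffices h : (i = 0 → koszulD b x = 0) ∧ ∀ j, i = j + 1 → koszulD b x ∈ ⋀[S]^j (Fin e → S) by
    rcases i with _ | j
    · exact Or.inl (h.1 rfl)
    · exact Or.inr ⟨j, rfl, h.2 j rfl⟩
  induction hx using Submodule.pow_induction_on_left' with
  | algebraMap r => exact ⟨fun _ => koszulD_algebraMap b r, by simp⟩
  | add x y i _ _ hx hy =>
    refine ⟨fun h => by rw [map_add, hx.1 h, hy.1 h, add_zero], fun j h => ?_⟩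
    rw [map_add]
    exact Submodule.add_mem _ (hx.2 j h) (hy.2 j h)
  | mem_mul m hm i x hx ih =>
    obtain ⟨v, rfl⟩ := hm
    refine ⟨by simp, fun j h => ?_⟩
    obtain rfl : i = j := by omega
    rw [koszulD_ι_mul]
    refine Submodule.sub_mem _ (Submodule.smul_mem _ _ hx) ?_
    rcases i with _ | k
    · rw [ih.1 rfl, mul_zero]; exact Submodule.zero_mem _
    · have h2 := ih.2 k rfl
      change _ ∈ (LinearMap.range (ExteriorAlgebra.ι S)) ^ (k + 1)
      rw [pow_succ']
      exact Submodule.mul_mem_mul (LinearMap.mem_range_self _ v) h2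

end Koszul

/-! ### DG modules over the Koszul complex and their derived category -/

/-- A (left) DG module over the Koszul complex `K` on the sequence `b` in `S`, in homological
grading: a `ℤ`-graded `S`-complex with a multiplication by `K` that is unitary, associative,
additive in degrees, and satisfies the Leibniz rule. -/
structure KoszulDGModule {S : Type u} [CommRing S] {e : ℕ} (b : Fin e → S) where
  /-- The direct sum of all components. -/
  carrier : Type u
  [addCommGroup : AddCommGroup carrier]
  [baseModule : Module S carrier]
  [module : Module (KoszulAlgebra S e) carrier]
  [isScalarTower : IsScalarTower S (KoszulAlgebra S e) carrier]
  /-- The homogeneous components. -/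
  deg : ℤ → Submodule S carrier
  isInternal : DirectSum.IsInternal deg
  smul_mem : ∀ {i : ℕ} {n : ℤ} {x : KoszulAlgebra S e} {y : carrier},
    x ∈ ⋀[S]^i (Fin e → S) → y ∈ deg n → x • y ∈ deg (i + n)
  /-- The differential. -/
  d : carrier →ₗ[S] carrier
  d_mem : ∀ {n : ℤ} {y : carrier}, y ∈ deg n → d y ∈ deg (n - 1)
  d_d : ∀ y : carrier, d (d y) = 0
  leibniz : ∀ {i : ℕ} {x : KoszulAlgebra S e}, x ∈ ⋀[S]^i (Fin e → S) → ∀ y : carrier,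
    d (x • y) = koszulD b x • y + (-1 : ℤ) ^ i • (x • d y)

namespace KoszulDGModule

attribute [instance] addCommGroup baseModule module isScalarTower

variable {S : Type u} [CommRing S] {e : ℕ} {b : Fin e → S}

/-- A morphism of DG modules: a `K`-linear map of degree `0` that commutes with the
differentials. -/
@[ext]
structure Hom (M N : KoszulDGModule b) where
  /-- The underlying linear map. -/
  toLin : M.carrier →ₗ[KoszulAlgebra S e] N.carrier
  map_mem : ∀ {n : ℤ} {y : M.carrier}, y ∈ M.deg n → toLin y ∈ N.deg n
  map_d : ∀ y : M.carrier, toLin (M.d y) = N.d (toLin y)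

instance : Category (KoszulDGModule b) where
  Hom M N := Hom M N
  id M := ⟨LinearMap.id, fun h => h, fun _ => rfl⟩
  comp f g := ⟨g.toLin.comp f.toLin, fun h => g.map_mem (f.map_mem h), fun y => by
    rw [LinearMap.comp_apply, f.map_d, g.map_d, LinearMap.comp_apply]⟩

/-- The homology `H(M) = ker d / im d` (the direct sum of the modules `H_n(M)`). -/
abbrev homology (M : KoszulDGModule b) : Type u :=
  LinearMap.ker M.d ⧸ (LinearMap.range M.d).submoduleOf (LinearMap.ker M.d)

/-- The restriction of a morphism of DG modules to cycles. -/
noncomputable def cyclesMap {M N : KoszulDGModule b} (f : M ⟶ N) :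
    LinearMap.ker M.d →ₗ[S] LinearMap.ker N.d :=
  (f.toLin.restrictScalars S).restrict fun y (hy : M.d y = 0) => by
    change N.d (f.toLin y) = 0
    rw [← f.map_d, hy, map_zero]

/-- The map `H(f) : H(M) → H(N)` induced by a morphism of DG modules. -/
noncomputable def homologyMap {M N : KoszulDGModule b} (f : M ⟶ N) :
    M.homology →ₗ[S] N.homology :=
  Submodule.mapQ _ _ (cyclesMap f) (by
    rintro ⟨y, hy⟩ ⟨z, hz⟩
    exact ⟨f.toLin z, by rw [← f.map_d, hz]; rfl⟩)

/-- Quasiisomorphisms: the morphisms of DG modules that are bijective in homology. -/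
def quasiIso (b : Fin e → S) : MorphismProperty (KoszulDGModule b) :=
  fun _ _ f => Function.Bijective (homologyMap f)

/-- The derived category of the category of DG modules over the Koszul complex: the localization
at the quasiisomorphisms. -/
abbrev Derived (b : Fin e → S) := (quasiIso b).Localization

/-- The localization functor from DG modules to the derived category. -/
abbrev toDerived (b : Fin e → S) : KoszulDGModule b ⥤ Derived b := (quasiIso b).Q

end KoszulDGModule

/-! ### Koszul extensions of complexes -/

section Tensor

variable {R : Type u} [CommRing R]

/-- The direct sum of all components of an `R`-complex. -/
abbrev totalModule (M : ChainComplex (ModuleCat.{u} R) ℤ) : Type u := ⨁ n : ℤ, M.X n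

/-- The differential of an `R`-complex, on the direct sum of all components. -/
noncomputable def totalD (M : ChainComplex (ModuleCat.{u} R) ℤ) :
    totalModule M →ₗ[R] totalModule M :=
  DirectSum.toModule R ℤ _ fun n =>
    (DirectSum.lof R ℤ (fun n => M.X n) (n - 1)).comp (M.d n (n - 1)).hom

theorem totalD_lof (M : ChainComplex (ModuleCat.{u} R) ℤ) (n : ℤ) (x : M.X n) :
    totalD M (DirectSum.lof R ℤ (fun n => M.X n) n x) =
      DirectSum.lof R ℤ (fun n => M.X n) (n - 1) ((M.d n (n - 1)).hom x) := by
  simp [totalD]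

theorem totalD_totalD (M : ChainComplex (ModuleCat.{u} R) ℤ) (x : totalModule M) :
    totalD M (totalD M x) = 0 := by
  suffices h : (totalD M).comp (totalD M) = 0 from LinearMap.congr_fun h x
  refine DirectSum.linearMap_ext R fun n => LinearMap.ext fun y => ?_
  simp only [LinearMap.comp_apply, totalD_lof]
  have h : (M.d (n - 1) (n - 1 - 1)).hom ((M.d n (n - 1)).hom y) = 0 := by
    rw [← LinearMap.comp_apply, ← ModuleCat.hom_comp, M.d_comp_d]; rfl
  rw [h]; simp

variable {S : Type u} [CommRing S] [Algebra R S] {e : ℕ} (b : Fin e → S)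
  (M : ChainComplex (ModuleCat.{u} R) ℤ)

/-- The degree `n` component of `K ⊗ M`: the sum of the images of all `K_i ⊗ M_j` with
`i + j = n`. -/
noncomputable def koszulTensorDeg (S : Type u) [CommRing S] [Algebra R S] (e : ℕ)
    (M : ChainComplex (ModuleCat.{u} R) ℤ) (n : ℤ) :
    Submodule S (KoszulAlgebra S e ⊗[R] totalModule M) :=
  Submodule.span S {t | ∃ (i : ℕ) (j : ℤ) (x : KoszulAlgebra S e) (y : M.X j),
    x ∈ ⋀[S]^i (Fin e → S) ∧ (i : ℤ) + j = n ∧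
      t = x ⊗ₜ[R] (DirectSum.lof R ℤ (fun n => M.X n) j y)}

/-- The differential of `K ⊗ M`: it sends `x ⊗ y` to `∂ x ⊗ y + (-1) ^ i x ⊗ ∂ y` for `x` of
degree `i`. -/
noncomputable def koszulTensorD :
    KoszulAlgebra S e ⊗[R] totalModule M →ₗ[S] KoszulAlgebra S e ⊗[R] totalModule M :=
  TensorProduct.AlgebraTensorModule.map (koszulD b) LinearMap.id +
    TensorProduct.AlgebraTensorModule.map (koszulSign S e) (totalD M)

theorem koszulTensorD_tmul (x : KoszulAlgebra S e) (y : totalModule M) :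
    koszulTensorD b M (x ⊗ₜ[R] y) = koszulD b x ⊗ₜ[R] y + koszulSign S e x ⊗ₜ[R] totalD M y :=
  rfl

theorem koszulTensorDeg_tmul_mem {i : ℕ} {j n : ℤ} {x : KoszulAlgebra S e}
    (hx : x ∈ ⋀[S]^i (Fin e → S)) (y : M.X j) (h : (i : ℤ) + j = n) :
    x ⊗ₜ[R] (DirectSum.lof R ℤ (fun n => M.X n) j y) ∈ koszulTensorDeg S e M n :=
  Submodule.subset_span ⟨i, j, x, y, hx, h, rfl⟩

theorem koszulTensorDeg_isInternal : DirectSum.IsInternal (koszulTensorDeg S e M) := by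
  classical
  let 𝒦 : ℕ → Submodule S (KoszulAlgebra S e) := fun i => ⋀[S]^i (Fin e → S)
  -- the decomposition `K ⊗ M → ⨁ (K ⊗ M)_n`
  let inc : ∀ p : ℕ × ℤ, (𝒦 p.1 ⊗[R] M.X p.2) →ₗ[S] KoszulAlgebra S e ⊗[R] totalModule M :=
    fun p => TensorProduct.AlgebraTensorModule.map (𝒦 p.1).subtype
      (DirectSum.lof R ℤ (fun n => M.X n) p.2)
  have hinc : ∀ p t, inc p t ∈ koszulTensorDeg S e M (p.1 + p.2) := by
    intro p t
    induction t using TensorProduct.induction_on with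
    | zero => rw [map_zero]; exact Submodule.zero_mem _
    | tmul x y => exact koszulTensorDeg_tmul_mem M x.2 y rfl
    | add x y hx hy => rw [map_add]; exact Submodule.add_mem _ hx hy
  let φ : (⨁ p : ℕ × ℤ, 𝒦 p.1 ⊗[R] M.X p.2) →ₗ[S] ⨁ n, koszulTensorDeg S e M n :=
    DirectSum.toModule S _ _ fun p =>
      (DirectSum.lof S ℤ (fun n => koszulTensorDeg S e M n) (p.1 + p.2)).comp
        ((inc p).codRestrict _ (hinc p))
  let D : KoszulAlgebra S e ⊗[R] totalModule M →ₗ[S] ⨁ n, koszulTensorDeg S e M n :=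
    φ ∘ₗ (TensorProduct.directSum R S (fun i => 𝒦 i) (fun n => M.X n)).toLinearMap ∘ₗ
      TensorProduct.AlgebraTensorModule.map
        (DirectSum.decomposeLinearEquiv 𝒦).toLinearMap LinearMap.id
  have hD : ∀ (i : ℕ) (j : ℤ) (x : KoszulAlgebra S e) (hx : x ∈ 𝒦 i) (y : M.X j),
      D (x ⊗ₜ[R] (DirectSum.lof R ℤ (fun n => M.X n) j y)) =
        DirectSum.lof S ℤ (fun n => koszulTensorDeg S e M n) (i + j)
          ⟨_, koszulTensorDeg_tmul_mem M hx y rfl⟩ := by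
    intro i j x hx y
    have h1 : DirectSum.decompose 𝒦 x = DirectSum.lof S ℕ (fun i => 𝒦 i) i ⟨x, hx⟩ :=
      DirectSum.decompose_of_mem 𝒦 hx
    have h2 : D (x ⊗ₜ[R] (DirectSum.lof R ℤ (fun n => M.X n) j y)) =
        φ (TensorProduct.directSum R S (fun i => 𝒦 i) (fun n => M.X n)
          (DirectSum.decompose 𝒦 x ⊗ₜ[R] (DirectSum.lof R ℤ (fun n => M.X n) j y))) := rfl
    rw [h2, h1, TensorProduct.directSum_lof_tmul_lof, DirectSum.toModule_lof]
    rfl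
  have hD' : ∀ n (t : koszulTensorDeg S e M n),
      D t = DirectSum.lof S ℤ (fun n => koszulTensorDeg S e M n) n t := by
    rintro n ⟨t, ht⟩
    induction ht using Submodule.span_induction with
    | mem t ht =>
      obtain ⟨i, j, x, y, hx, rfl, rfl⟩ := ht
      exact hD i j x hx y
    | zero =>
      change D 0 = DirectSum.lof S ℤ (fun n => koszulTensorDeg S e M n) n 0
      rw [map_zero, map_zero]
    | add t t' ht ht' h h' =>
      change D (t + t') = DirectSum.lof S ℤ (fun n => koszulTensorDeg S e M n) n
        (⟨t, ht⟩ + ⟨t', ht'⟩)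
      rw [map_add, map_add, ← h, ← h']
    | smul s t ht h =>
      change D (s • t) = DirectSum.lof S ℤ (fun n => koszulTensorDeg S e M n) n (s • ⟨t, ht⟩)
      rw [map_smul, map_smul, ← h]
  refine @DirectSum.Decomposition.isInternal _ _ _ _ _ _ _ (koszulTensorDeg S e M)
    (DirectSum.Decomposition.ofLinearMap _ D ?_ ?_)
  · refine LinearMap.ext fun t => ?_
    induction t using TensorProduct.induction_on with
    | zero => rw [map_zero, map_zero]
    | add x y hx hy => rw [map_add, map_add, hx, hy]
    | tmul x y =>
      induction x using DirectSum.Decomposition.inductionOn 𝒦 with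
      | zero => rw [TensorProduct.zero_tmul, map_zero, map_zero]
      | add x x' hx hx' => rw [TensorProduct.add_tmul, map_add, map_add, hx, hx']
      | @homogeneous i x =>
        induction y using DirectSum.induction_on with
        | zero => rw [TensorProduct.tmul_zero, map_zero, map_zero]
        | add y y' hy hy' => rw [TensorProduct.tmul_add, map_add, map_add, hy, hy']
        | of j y =>
          have h := hD i j x x.2 y
          have h' := congrArg (DirectSum.coeLinearMap (koszulTensorDeg S e M)) h
          rw [DirectSum.coeLinearMap_lof] at h'
          exact h'
  · refine DirectSum.linearMap_ext S fun n => LinearMap.ext fun t => ?_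
    simp only [LinearMap.comp_apply, DirectSum.coeLinearMap_lof, LinearMap.id_apply]
    exact hD' n t

theorem koszulTensorD_mem {n : ℤ} {t : KoszulAlgebra S e ⊗[R] totalModule M}
    (ht : t ∈ koszulTensorDeg S e M n) : koszulTensorD b M t ∈ koszulTensorDeg S e M (n - 1) := by
  induction ht using Submodule.span_induction with
  | zero => rw [map_zero]; exact Submodule.zero_mem _
  | add x y _ _ hx hy => rw [map_add]; exact Submodule.add_mem _ hx hy
  | smul s x _ hx => rw [map_smul]; exact Submodule.smul_mem _ _ hx
  | mem t ht =>
    obtain ⟨i, j, x, y, hx, rfl, rfl⟩ := ht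
    rw [koszulTensorD_tmul, totalD_lof]
    refine Submodule.add_mem _ ?_ ?_
    · rcases koszulD_mem b hx with h | ⟨k, rfl, h⟩
      · rw [h, TensorProduct.zero_tmul]; exact Submodule.zero_mem _
      · exact koszulTensorDeg_tmul_mem M h y (by push_cast; ring)
    · refine koszulTensorDeg_tmul_mem M (i := i) ?_ _ (by ring)
      rw [koszulSign_of_mem hx]
      exact zsmul_mem hx _

theorem koszulSign_koszulSign (x : KoszulAlgebra S e) : koszulSign S e (koszulSign S e x) = x :=
  CliffordAlgebra.involute_involute (Q := (0 : QuadraticForm S (Fin e → S))) x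

theorem koszulD_koszulSign (x : KoszulAlgebra S e) :
    koszulD b (koszulSign S e x) = -koszulSign S e (koszulD b x) := by
  induction x using DirectSum.Decomposition.inductionOn (fun i : ℕ => ⋀[S]^i (Fin e → S)) with
  | zero => simp
  | add x y hx hy => rw [map_add, map_add, map_add, map_add, hx, hy, neg_add]
  | @homogeneous i x =>
    rw [koszulSign_of_mem x.2, map_zsmul]
    rcases koszulD_mem b x.2 with h | ⟨k, rfl, h⟩
    · rw [h]; simp
    · rw [koszulSign_of_mem h, pow_succ']
      simp

theorem koszulTensorD_koszulTensorD (t : KoszulAlgebra S e ⊗[R] totalModule M) :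
    koszulTensorD b M (koszulTensorD b M t) = 0 := by
  induction t using TensorProduct.induction_on with
  | zero => simp
  | add x y hx hy => rw [map_add, map_add, hx, hy, add_zero]
  | tmul x y =>
    rw [koszulTensorD_tmul, map_add, koszulTensorD_tmul, koszulTensorD_tmul, koszulD_koszulD,
      totalD_totalD, koszulD_koszulSign, TensorProduct.zero_tmul, TensorProduct.tmul_zero,
      TensorProduct.neg_tmul]
    abel

theorem koszulTensorD_smul (x : KoszulAlgebra S e) (t : KoszulAlgebra S e ⊗[R] totalModule M) :
    koszulTensorD b M (x • t) =
      koszulD b x • t + koszulSign S e x • koszulTensorD b M t := by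
  induction t using TensorProduct.induction_on with
  | zero => simp
  | add y z hy hz => rw [smul_add, map_add, hy, hz, smul_add, map_add, smul_add]; abel
  | tmul z y =>
    simp only [TensorProduct.smul_tmul', smul_eq_mul, koszulTensorD_tmul, koszulD_mul,
      koszulSign_mul, smul_add, TensorProduct.add_tmul, add_assoc]

/-- For an `R`-algebra `S`, a sequence `b` in `S` and an `R`-complex `M`, the DG module
`K ⊗[R] M` over the Koszul complex `K` on `b`, with multiplication `x (x' ⊗ y) = (x x') ⊗ y`. -/
noncomputable def koszulTensor : KoszulDGModule b where
  carrier := KoszulAlgebra S e ⊗[R] totalModule M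
  deg := koszulTensorDeg S e M
  isInternal := koszulTensorDeg_isInternal M
  smul_mem {i n x t} hx ht := by
    induction ht using Submodule.span_induction with
    | zero => rw [smul_zero]; exact Submodule.zero_mem _
    | add x y _ _ hx hy => rw [smul_add]; exact Submodule.add_mem _ hx hy
    | smul s t _ ht => rw [smul_comm]; exact Submodule.smul_mem _ _ ht
    | mem t ht =>
      obtain ⟨k, j, z, y, hz, rfl, rfl⟩ := ht
      rw [TensorProduct.smul_tmul', smul_eq_mul]
      refine koszulTensorDeg_tmul_mem M (i := i + k) ?_ y (by push_cast; ring)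
      exact SetLike.GradedMul.mul_mem (A := fun i : ℕ => ⋀[S]^i (Fin e → S)) hx hz
  d := koszulTensorD b M
  d_mem := koszulTensorD_mem b M
  d_d := koszulTensorD_koszulTensorD b M
  leibniz {i x} hx t := by
    rw [koszulTensorD_smul, koszulSign_of_mem hx]
    congr 1
    exact map_zsmul ((smulAddHom (KoszulAlgebra S e)
      (KoszulAlgebra S e ⊗[R] totalModule M)).flip (koszulTensorD b M t)) _ x

end Tensor

/-! ### Completions and complexes of free modules -/

/-- The completion of a local ring with respect to its maximal ideal. -/
abbrev LocalCompletion (R : Type u) [CommRing R] [IsLocalRing R] : Type u :=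
  AdicCompletion (IsLocalRing.maximalIdeal R) R

/-- A finite sequence in the maximal ideal `𝔪` of a local ring `R` is co-complete if the local ring
`R ⧸ (a)` is complete with respect to its maximal ideal `𝔪 ⧸ (a)`. -/
def IsCoComplete {R : Type u} [CommRing R] [IsLocalRing R] {e : ℕ} (a : Fin e → R) : Prop :=
  (∀ i, a i ∈ IsLocalRing.maximalIdeal R) ∧
    IsAdicComplete
      ((IsLocalRing.maximalIdeal R).map (Ideal.Quotient.mk (Ideal.span (Set.range a))))
      (R ⧸ Ideal.span (Set.range a))

/-- `M` is a complex of finite rank free modules with `M_n = 0` for `n < 0` and for `n > m`. -/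
def IsFiniteFreeComplex {R : Type u} [CommRing R] (m : ℕ)
    (M : ChainComplex (ModuleCat.{u} R) ℤ) : Prop :=
  (∀ n, Module.Free R (M.X n) ∧ Module.Finite R (M.X n)) ∧
    ∀ n : ℤ, n < 0 ∨ (m : ℤ) < n → Subsingleton (M.X n)

/-- `x` is a solution, in the `R`-algebra `T`, to the system of equations `p = 0` for `p ∈ 𝒮`. -/
def IsSolution {R : Type u} [CommRing R] {k : ℕ} (𝒮 : Finset (MvPolynomial (Fin k) R))
    {T : Type u} [CommRing T] [Algebra R T] (x : Fin k → T) : Prop :=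
  ∀ p ∈ 𝒮, MvPolynomial.aeval x p = 0

/-!
Write `S` for the completion of `R`, `K^T` for the Koszul algebra over an `R`-algebra `T` on the
image of the sequence `a`, and fix a basis of the total module of `P`, indexed by a finite set `N`
and with the basis vectors in degrees `deg`.

The complex `P` itself need not be defined over `R`, but its Koszul extension is, as a *twisted
module*: there is a differential `D` on the free `K^R`-module `K^R ^ N` (`twistedD`), satisfying the
Leibniz rule, whose extension to `S` is isomorphic to `K^S ⊗ P` (`exists_isKoszulModel`).  It is
built degree by degree.  The boundary of a basis vector in the next degree is a cycle over `S` of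
the part already constructed, and such a cycle is homologous to a cycle over `R`
(`exists_cycle_of_flat`): since `S` is flat over `R`, it is an `S`-combination of cycles over `R`,
and since multiplication by each `a i` is null-homotopic and `R → S ⧸ (a)` is surjective
(`IsCoComplete.exists_eq_add_sum`), the coefficients may be taken in `R` up to a boundary.  The
boundary is absorbed by changing the basis vector, so the resulting isomorphism is given by a
homogeneous unitriangular matrix `φ` over `K^S`.

With `D` fixed, consider the pairs `(X, φ)` of a square-zero matrix `X` of degree `-1` over `T`, that
is, a complex of free `T`-modules, and a homogeneous unitriangular matrix `φ` over `K^T` that is a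
morphism from its Koszul extension to the extension of the twisted module (`IsKoszulModel`).  These
are the solutions in `T` of a polynomial system with coefficients in `R` (`exists_system`), because
the Koszul algebra has a finite basis compatible with changes of the base ring.  The matrix of the
differential of `P` is part of a solution in `S`.  A solution in `R` yields a complex `A` together
with an isomorphism from `K^S ⊗ A` to the same twisted module over `S`, since unitriangular
matrices are invertible (`linearCombination_bijective`).  Hence `K^S ⊗ A` and `K^S ⊗ P` are even
isomorphic as DG modules.
-/

/-! ### Functoriality and grading of the Koszul algebra -/

section KoszulFunctoriality

variable {T T' T'' : Type u} [CommRing T] [CommRing T'] [CommRing T''] {e : ℕ}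

/-- The homomorphism of Koszul algebras induced by a ring homomorphism `g`, which applies `g` to the
coordinates of vectors.  It takes a bare ring homomorphism, not an algebra instance, so that it can
be used for evaluations of polynomials. -/
noncomputable def koszulMap (g : T →+* T') (e : ℕ) : KoszulAlgebra T e →+* KoszulAlgebra T' e :=
  letI := g.toAlgebra
  (ExteriorAlgebra.lift T (A := KoszulAlgebra T' e)
    ⟨((ExteriorAlgebra.ι T').restrictScalars T).comp ((Algebra.linearMap T T').compLeft (Fin e)),
      fun _ => ExteriorAlgebra.ι_sq_zero _⟩ : KoszulAlgebra T e →ₐ[T] KoszulAlgebra T' e).toRingHom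

theorem koszulMap_algebraMap (g : T →+* T') (t : T) :
    koszulMap g e (algebraMap T _ t) = algebraMap T' _ (g t) := by
  let := g.toAlgebra
  refine (AlgHom.commutes (ExteriorAlgebra.lift T _) t).trans ?_
  exact IsScalarTower.algebraMap_apply T T' _ t

theorem koszulMap_ι (g : T →+* T') (v : Fin e → T) :
    koszulMap g e (ExteriorAlgebra.ι T v) = ExteriorAlgebra.ι T' (fun i => g (v i)) := by
  let := g.toAlgebra
  exact ExteriorAlgebra.lift_ι_apply T _ _ v

theorem koszulMap_smul (g : T →+* T') (t : T) (x : KoszulAlgebra T e) :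
    koszulMap g e (t • x) = g t • koszulMap g e x := by
  rw [Algebra.smul_def, map_mul, koszulMap_algebraMap, ← Algebra.smul_def]

theorem koszulAlgebra_induction {C : KoszulAlgebra T e → Prop}
    (algebraMap : ∀ t, C (algebraMap T _ t)) (add : ∀ x y, C x → C y → C (x + y))
    (ι_mul : ∀ v x, C x → C (ExteriorAlgebra.ι T v * x)) (x : KoszulAlgebra T e) : C x :=
  CliffordAlgebra.left_induction (Q := (0 : QuadraticForm T (Fin e → T))) algebraMap add
    (fun x v h => ι_mul v x h) x

theorem koszulMap_comp (g : T →+* T') (h : T' →+* T'') (x : KoszulAlgebra T e) :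
    koszulMap h e (koszulMap g e x) = koszulMap (h.comp g) e x := by
  induction x using koszulAlgebra_induction with
  | algebraMap t => simp only [koszulMap_algebraMap, RingHom.comp_apply]
  | add x y hx hy => simp only [map_add, hx, hy]
  | ι_mul v x hx => simp only [map_mul, koszulMap_ι, hx, RingHom.comp_apply]

theorem koszulMap_d (g : T →+* T') (b : Fin e → T) (x : KoszulAlgebra T e) :
    koszulMap g e (koszulD b x) = koszulD (fun i => g (b i)) (koszulMap g e x) := by
  induction x using koszulAlgebra_induction with
  | algebraMap t => rw [koszulMap_algebraMap, koszulD_algebraMap, koszulD_algebraMap, map_zero]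
  | add x y hx hy => simp only [map_add, hx, hy]
  | ι_mul v x hx =>
    rw [koszulD_ι_mul, map_mul, koszulMap_ι, koszulD_ι_mul, map_sub, map_mul, hx, koszulMap_ι,
      koszulMap_smul, map_sum]
    simp only [map_mul]

theorem koszulMap_sign (g : T →+* T') (x : KoszulAlgebra T e) :
    koszulMap g e (koszulSign T e x) = koszulSign T' e (koszulMap g e x) := by
  induction x using koszulAlgebra_induction with
  | algebraMap t => simp only [koszulMap_algebraMap, koszulSign_algebraMap]
  | add x y hx hy => simp only [map_add, hx, hy]
  | ι_mul v x hx =>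
    rw [koszulSign_mul, koszulSign_ι, map_mul, map_mul, map_neg, koszulMap_ι, koszulSign_mul,
      koszulSign_ι, hx]

theorem koszulMap_mem (g : T →+* T') {i : ℕ} {x : KoszulAlgebra T e}
    (hx : x ∈ ⋀[T]^i (Fin e → T)) : koszulMap g e x ∈ ⋀[T']^i (Fin e → T') := by
  induction hx using Submodule.pow_induction_on_left' with
  | algebraMap t =>
    rw [koszulMap_algebraMap]
    change _ ∈ (LinearMap.range (ExteriorAlgebra.ι T')) ^ 0
    rw [pow_zero]
    exact Submodule.algebraMap_mem _
  | add x y i _ _ hx hy => rw [map_add]; exact Submodule.add_mem _ hx hy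
  | mem_mul m hm i x _ ih =>
    obtain ⟨v, rfl⟩ := hm
    rw [map_mul, koszulMap_ι]
    change _ ∈ (LinearMap.range (ExteriorAlgebra.ι T')) ^ (i + 1)
    rw [pow_succ']
    exact Submodule.mul_mem_mul (LinearMap.mem_range_self _ _) ih

theorem koszulAlgebra_homogeneous_induction {C : KoszulAlgebra T e → Prop} (zero : C 0)
    (add : ∀ x y, C x → C y → C (x + y))
    (mem : ∀ (i : ℕ) (x), x ∈ ⋀[T]^i (Fin e → T) → C x) (x : KoszulAlgebra T e) : C x :=
  DirectSum.Decomposition.inductionOn (fun i : ℕ => ⋀[T]^i (Fin e → T)) zero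
    (fun {i} x => mem i x x.2) add x

/-- The projection of the Koszul algebra onto its component of degree `z`, for an arbitrary
integer `z`; it is zero when `z` is negative. -/
noncomputable def koszulProj (T : Type u) [CommRing T] (e : ℕ) (z : ℤ) :
    KoszulAlgebra T e →ₗ[T] KoszulAlgebra T e :=
  if 0 ≤ z then GradedAlgebra.proj (fun i : ℕ => ⋀[T]^i (Fin e → T)) z.toNat else 0

theorem koszulProj_of_mem {i : ℕ} {x : KoszulAlgebra T e} (hx : x ∈ ⋀[T]^i (Fin e → T)) (z : ℤ) :
    koszulProj T e z x = if (i : ℤ) = z then x else 0 := by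
  unfold koszulProj
  split_ifs with h1 h2 h2
  · subst h2
    rw [GradedAlgebra.proj_apply, Int.toNat_natCast]
    exact DirectSum.decompose_of_mem_same (fun i : ℕ => ⋀[T]^i (Fin e → T)) hx
  · rw [GradedAlgebra.proj_apply]
    exact DirectSum.decompose_of_mem_ne (fun i : ℕ => ⋀[T]^i (Fin e → T)) hx (by omega)
  · omega
  · rfl

theorem koszulProj_mem (i : ℕ) (x : KoszulAlgebra T e) :
    koszulProj T e i x ∈ ⋀[T]^i (Fin e → T) := by
  rw [koszulProj, if_pos (Int.natCast_nonneg i), GradedAlgebra.proj_apply, Int.toNat_natCast]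
  exact SetLike.coe_mem _

theorem koszulProj_of_neg {z : ℤ} (hz : z < 0) (x : KoszulAlgebra T e) :
    koszulProj T e z x = 0 := by
  rw [koszulProj, if_neg (by omega)]; rfl

theorem koszulProj_proj (z : ℤ) (x : KoszulAlgebra T e) :
    koszulProj T e z (koszulProj T e z x) = koszulProj T e z x := by
  rcases lt_or_ge z 0 with hz | hz
  · simp only [koszulProj_of_neg hz]
  · lift z to ℕ using hz
    rw [koszulProj_of_mem (koszulProj_mem z x), if_pos rfl]

theorem koszulMap_proj (g : T →+* T') (z : ℤ) (x : KoszulAlgebra T e) :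
    koszulMap g e (koszulProj T e z x) = koszulProj T' e z (koszulMap g e x) := by
  induction x using koszulAlgebra_homogeneous_induction with
  | zero => simp only [map_zero]
  | add x y hx hy => simp only [map_add, hx, hy]
  | mem i x hx =>
    rw [koszulProj_of_mem hx, koszulProj_of_mem (koszulMap_mem g hx)]
    split_ifs <;> simp

theorem koszulProj_d (b : Fin e → T) (z : ℤ) (x : KoszulAlgebra T e) :
    koszulProj T e (z - 1) (koszulD b x) = koszulD b (koszulProj T e z x) := by
  induction x using koszulAlgebra_homogeneous_induction with
  | zero => simp only [map_zero]
  | add x y hx hy => simp only [map_add, hx, hy]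
  | mem i x hx =>
    rw [koszulProj_of_mem hx]
    rcases koszulD_mem b hx with h | ⟨j, rfl, h⟩
    · rw [h, map_zero]; split_ifs <;> simp [h]
    · rw [koszulProj_of_mem h]
      by_cases hz : ((j + 1 : ℕ) : ℤ) = z
      · rw [if_pos hz, if_pos (by push_cast at hz; omega)]
      · rw [if_neg hz, if_neg (by push_cast at hz; omega), map_zero]

theorem koszulProj_sign (z : ℤ) (x : KoszulAlgebra T e) :
    koszulProj T e z (koszulSign T e x) = koszulSign T e (koszulProj T e z x) := by
  induction x using koszulAlgebra_homogeneous_induction with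
  | zero => simp only [map_zero]
  | add x y hx hy => simp only [map_add, hx, hy]
  | mem i x hx =>
    rw [koszulSign_of_mem hx, map_zsmul, koszulProj_of_mem hx]
    split_ifs
    · rw [koszulSign_of_mem hx]
    · simp

/-- Multiplication by a homogeneous element `y` shifts the projections by the degree of `y`, which
may be any integer: in negative degrees, `y` is zero. -/
theorem koszulProj_mul {y : KoszulAlgebra T e} {c : ℤ} (hy : koszulProj T e c y = y) (z : ℤ)
    (x : KoszulAlgebra T e) :
    koszulProj T e (z + c) (x * y) = koszulProj T e z x * y := by
  rcases lt_or_ge c 0 with hc | hc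
  · rw [koszulProj_of_neg hc] at hy
    simp [← hy]
  lift c to ℕ using hc
  have hy' : y ∈ ⋀[T]^c (Fin e → T) := hy ▸ koszulProj_mem c y
  induction x using koszulAlgebra_homogeneous_induction with
  | zero => simp only [map_zero, zero_mul]
  | add x y hx hy => simp only [map_add, add_mul, hx, hy]
  | mem i x hx =>
    have hxy : x * y ∈ ⋀[T]^(i + c) (Fin e → T) :=
      SetLike.GradedMul.mul_mem (A := fun i : ℕ => ⋀[T]^i (Fin e → T)) hx hy'
    rw [koszulProj_of_mem hx, koszulProj_of_mem hxy]
    by_cases hz : (i : ℤ) = z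
    · rw [if_pos hz, if_pos (by push_cast; omega)]
    · rw [if_neg hz, if_neg (by push_cast; omega), zero_mul]

/-- The Koszul differential vanishes on elements of degree at most `0`. -/
theorem koszulD_of_proj {b : Fin e → T} {z : ℤ} (hz : z ≤ 0) {x : KoszulAlgebra T e}
    (hx : koszulProj T e z x = x) : koszulD b x = 0 := by
  rw [← hx, ← koszulProj_d, koszulProj_of_neg (by omega)]

theorem koszulProj_one : koszulProj T e 0 1 = 1 := by
  have h : (1 : KoszulAlgebra T e) ∈ ⋀[T]^0 (Fin e → T) :=
    Submodule.one_le.mp (pow_zero (LinearMap.range (ExteriorAlgebra.ι T))).ge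
  rw [koszulProj_of_mem h]; rfl

/-- The basis of the Koszul algebra formed by the exterior products of standard basis vectors. -/
noncomputable def koszulBasis (T : Type u) [CommRing T] (e : ℕ) :
    Module.Basis (Finset (Fin e)) T (KoszulAlgebra T e) :=
  (Pi.basisFun T (Fin e)).ExteriorAlgebra

theorem koszulMap_basis (g : T →+* T') (I : Finset (Fin e)) :
    koszulMap g e (koszulBasis T e I) = koszulBasis T' e I := by
  rw [koszulBasis, koszulBasis, ExteriorAlgebra.basis_apply, ExteriorAlgebra.basis_apply]
  unfold ExteriorAlgebra.ιMulti_family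
  rw [ExteriorAlgebra.ιMulti_apply, ExteriorAlgebra.ιMulti_apply, map_list_prod, List.map_ofFn]
  congr 2
  funext j
  simp only [Function.comp_apply, koszulMap_ι, Pi.basisFun_apply]
  congr 1
  funext i
  rw [Pi.single_apply, Pi.single_apply]
  split_ifs <;> simp

theorem koszulBasis_repr_map (g : T →+* T') (x : KoszulAlgebra T e) (I : Finset (Fin e)) :
    (koszulBasis T' e).repr (koszulMap g e x) I = g ((koszulBasis T e).repr x I) := by
  have h : koszulMap g e x =
      ∑ J, g ((koszulBasis T e).repr x J) • koszulBasis T' e J := by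
    conv_lhs => rw [← (koszulBasis T e).sum_repr x]
    simp only [map_sum, koszulMap_smul, koszulMap_basis]
  rw [h, Module.Basis.repr_sum_self]

end KoszulFunctoriality

/-! ### Twisted differentials on free modules over the Koszul algebra -/

section FreeGrading

variable {T : Type u} [CommRing T] {e : ℕ} {N : Type*}

/-- The projection of `K ^ N` onto its component of degree `n`, where the `i`-th basis vector has
degree `deg i`. -/
noncomputable def freeProj (T : Type u) [CommRing T] (e : ℕ) (deg : N → ℤ) (n : ℤ) :
    (N → KoszulAlgebra T e) →ₗ[T] (N → KoszulAlgebra T e) :=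
  LinearMap.pi fun i => koszulProj T e (n - deg i) ∘ₗ LinearMap.proj i

theorem freeProj_apply (deg : N → ℤ) (n : ℤ) (w : N → KoszulAlgebra T e) (i : N) :
    freeProj T e deg n w i = koszulProj T e (n - deg i) (w i) := rfl

theorem freeProj_proj (deg : N → ℤ) (n : ℤ) (w : N → KoszulAlgebra T e) :
    freeProj T e deg n (freeProj T e deg n w) = freeProj T e deg n w :=
  funext fun _ => koszulProj_proj _ _

/-- A homogeneous element has no component along basis vectors of larger degree. -/
theorem apply_eq_zero_of_freeProj {deg : N → ℤ} {n : ℤ} {w : N → KoszulAlgebra T e}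
    (hw : freeProj T e deg n w = w) {i : N} (hi : n < deg i) : w i = 0 := by
  rw [← hw, freeProj_apply, koszulProj_of_neg (by omega)]

end FreeGrading

section Twisted

variable {T T' : Type u} [CommRing T] [CommRing T'] {e : ℕ} {N : Type*} [Fintype N]

/-- The differential on the free module `K ^ N` over the Koszul algebra `K` that satisfies the
Leibniz rule and sends the `j`-th basis vector to `c j`.  It squares to zero if it kills every
`c j` (see `twistedD_twistedD`). -/
noncomputable def twistedD (b : Fin e → T) (c : N → N → KoszulAlgebra T e) :
    (N → KoszulAlgebra T e) →ₗ[T] (N → KoszulAlgebra T e) where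
  toFun w := (fun i => koszulD b (w i)) + ∑ j, koszulSign T e (w j) • c j
  map_add' w w' := by
    refine funext fun i => ?_
    simp only [Pi.add_apply, map_add, add_smul, Finset.sum_add_distrib]
    abel
  map_smul' t w := by
    refine funext fun i => ?_
    simp only [Pi.add_apply, Pi.smul_apply, map_smul, smul_assoc, ← Finset.smul_sum, ← smul_add,
      RingHom.id_apply]

theorem twistedD_apply (b : Fin e → T) (c : N → N → KoszulAlgebra T e)
    (w : N → KoszulAlgebra T e) :
    twistedD b c w = (fun i => koszulD b (w i)) + ∑ j, koszulSign T e (w j) • c j := rfl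

theorem twistedD_smul (b : Fin e → T) (c : N → N → KoszulAlgebra T e) (k : KoszulAlgebra T e)
    (w : N → KoszulAlgebra T e) :
    twistedD b c (k • w) = koszulD b k • w + koszulSign T e k • twistedD b c w := by
  have h : (fun i => koszulD b ((k • w) i)) =
      koszulD b k • w + koszulSign T e k • fun i => koszulD b (w i) :=
    funext fun i => koszulD_mul b k (w i)
  rw [twistedD_apply, twistedD_apply, h, smul_add, Finset.smul_sum, add_assoc]
  simp only [Pi.smul_apply, smul_eq_mul, koszulSign_mul, mul_smul]

theorem twistedD_twistedD (b : Fin e → T) {c : N → N → KoszulAlgebra T e}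
    (hc : ∀ j, twistedD b c (c j) = 0) (w : N → KoszulAlgebra T e) :
    twistedD b c (twistedD b c w) = 0 := by
  have h : twistedD b c (fun i => koszulD b (w i)) =
      ∑ j, koszulSign T e (koszulD b (w j)) • c j := by
    rw [twistedD_apply]
    simp only [koszulD_koszulD]
    exact zero_add _
  rw [twistedD_apply b c w, map_add, h, map_sum]
  simp only [twistedD_smul, hc, smul_zero, add_zero, koszulD_koszulSign, neg_smul,
    Finset.sum_neg_distrib, add_neg_cancel]

/-- The `K`-linear endomorphism with rows `φ j` commutes with twisted differentials if it does so
on the basis vectors. -/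
theorem twistedD_linearCombination (b : Fin e → T) {c c' φ : N → N → KoszulAlgebra T e}
    (h : ∀ j, twistedD b c (φ j) = Fintype.linearCombination (KoszulAlgebra T e) φ (c' j))
    (w : N → KoszulAlgebra T e) :
    twistedD b c (Fintype.linearCombination (KoszulAlgebra T e) φ w) =
      Fintype.linearCombination (KoszulAlgebra T e) φ (twistedD b c' w) := by
  rw [twistedD_apply b c' w, map_add, map_sum, Fintype.linearCombination_apply, map_sum,
    Fintype.linearCombination_apply]
  simp only [twistedD_smul, h, map_smul, Finset.sum_add_distrib]

theorem twistedD_congr (b : Fin e → T) {c c' : N → N → KoszulAlgebra T e}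
    {w : N → KoszulAlgebra T e} (h : ∀ j, w j = 0 ∨ c j = c' j) :
    twistedD b c w = twistedD b c' w := by
  rw [twistedD_apply, twistedD_apply]
  congr 1
  refine Finset.sum_congr rfl fun j _ => ?_
  rcases h j with h | h
  · rw [h, map_zero, zero_smul, zero_smul]
  · rw [h]

theorem koszulMap_twistedD (g : T →+* T') (b : Fin e → T) (c : N → N → KoszulAlgebra T e)
    (w : N → KoszulAlgebra T e) (i : N) :
    koszulMap g e (twistedD b c w i) =
      twistedD (fun i => g (b i)) (fun j i => koszulMap g e (c j i))
        (fun i => koszulMap g e (w i)) i := by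
  simp only [twistedD_apply, Pi.add_apply, Finset.sum_apply, Pi.smul_apply, smul_eq_mul, map_add,
    map_sum, map_mul, koszulMap_d, koszulMap_sign]

theorem freeProj_sum_smul (deg : N → ℤ) (r n : ℤ) {φ : N → N → KoszulAlgebra T e}
    (hφ : ∀ j, freeProj T e deg (deg j + r) (φ j) = φ j) (w : N → KoszulAlgebra T e) :
    freeProj T e deg (n + r) (∑ j, w j • φ j) =
      ∑ j, koszulProj T e (n - deg j) (w j) • φ j := by
  rw [map_sum]
  refine Finset.sum_congr rfl fun j _ => funext fun i => ?_
  have h := koszulProj_mul (congrFun (hφ j) i) (n - deg j) (w j)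
  rw [show n - deg j + (deg j + r - deg i) = n + r - deg i by ring] at h
  exact h

theorem freeProj_linearCombination (deg : N → ℤ) (n : ℤ) {φ : N → N → KoszulAlgebra T e}
    (hφ : ∀ j, freeProj T e deg (deg j) (φ j) = φ j) (w : N → KoszulAlgebra T e) :
    freeProj T e deg n (Fintype.linearCombination (KoszulAlgebra T e) φ w) =
      Fintype.linearCombination (KoszulAlgebra T e) φ (freeProj T e deg n w) := by
  have h := freeProj_sum_smul deg 0 n (φ := φ) (by simpa using hφ) w
  rw [add_zero] at h
  exact h

theorem freeProj_twistedD (b : Fin e → T) (deg : N → ℤ) (n : ℤ) {c : N → N → KoszulAlgebra T e}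
    (hc : ∀ j, freeProj T e deg (deg j - 1) (c j) = c j) (w : N → KoszulAlgebra T e) :
    freeProj T e deg (n - 1) (twistedD b c w) = twistedD b c (freeProj T e deg n w) := by
  rw [twistedD_apply, twistedD_apply, map_add]
  congr 1
  · funext i
    have h := koszulProj_d b (n - deg i) (w i)
    rw [show n - deg i - 1 = n - 1 - deg i by ring] at h
    exact h
  · refine (freeProj_sum_smul deg (-1) n hc fun j => koszulSign T e (w j)).trans ?_
    simp only [koszulProj_sign, freeProj_apply]

/-- An endomorphism of `K ^ N` that is unitriangular with respect to a function `deg` is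
bijective: it differs from the identity by a nilpotent endomorphism. -/
theorem linearCombination_bijective [DecidableEq N] (deg : N → ℤ) (hdeg : ∀ i, 0 ≤ deg i)
    {φ : N → N → KoszulAlgebra T e}
    (hφ : ∀ j i, ¬ deg i < deg j → φ j i = if i = j then 1 else 0) :
    Function.Bijective (Fintype.linearCombination (KoszulAlgebra T e) φ) := by
  let L : Module.End (KoszulAlgebra T e) (N → KoszulAlgebra T e) :=
    Fintype.linearCombination (KoszulAlgebra T e) φ
  have hL : ∀ w i, (L - 1) w i = ∑ j, w j * (φ j i - if i = j then 1 else 0) := by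
    intro w i
    have h : L w i = ∑ j, w j * φ j i := by
      simp [L, Fintype.linearCombination_apply, Finset.sum_apply]
    rw [LinearMap.sub_apply, Pi.sub_apply, h, Module.End.one_apply]
    simp [mul_sub, Finset.sum_sub_distrib]
  have key : ∀ (s : ℕ) (w : N → KoszulAlgebra T e), (∀ i, (s : ℤ) ≤ deg i → w i = 0) →
      ((L - 1) ^ s) w = 0 := by
    intro s
    induction s with
    | zero => intro w hw; exact funext fun i => hw i (by simpa using hdeg i)
    | succ s ih =>
      intro w hw
      rw [pow_succ, Module.End.mul_apply]
      refine ih _ fun i hi => ?_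
      rw [hL]
      refine Finset.sum_eq_zero fun j _ => ?_
      by_cases hj : deg i < deg j
      · rw [hw j (by push_cast; omega), zero_mul]
      · rw [hφ j i hj, sub_self, mul_zero]
  have hnil : IsNilpotent (L - 1) := by
    refine ⟨∑ i, (deg i).toNat + 1, LinearMap.ext fun w => key _ w fun i hi => ?_⟩
    have h : (deg i).toNat ≤ ∑ i, (deg i).toNat :=
      Finset.single_le_sum (f := fun i => (deg i).toNat) (fun _ _ => Nat.zero_le _)
        (Finset.mem_univ i)
    have := hdeg i
    omega
  have hunit := hnil.isUnit_one_add
  rw [add_sub_cancel] at hunit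
  exact (Module.End.isUnit_iff L).1 hunit

end Twisted

/-! ### Cycles over a flat extension -/

section FlatExtension

variable {R S : Type u} [CommRing R] [CommRing S] [Algebra R S] {e : ℕ} {N : Type*}

/-- The extension of scalars `K^R ^ N → K^S ^ N`. -/
noncomputable def freeExtend (R S : Type u) [CommRing R] [CommRing S] [Algebra R S] (e : ℕ)
    (N : Type*) : (N → KoszulAlgebra R e) →ₗ[R] (N → KoszulAlgebra S e) where
  toFun w i := koszulMap (algebraMap R S) e (w i)
  map_add' w w' := funext fun i => map_add _ _ _
  map_smul' r w := funext fun i => by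
    simp only [Pi.smul_apply, koszulMap_smul, RingHom.id_apply, algebraMap_smul]

/-- This holds because the standard basis over `R` maps to the standard basis over `S`. -/
theorem freeExtend_isBaseChange [Finite N] : IsBaseChange S (freeExtend R S e N) := by
  cases nonempty_fintype N
  let B := Pi.basis fun _ : N => koszulBasis R e
  let B' := Pi.basis fun _ : N => koszulBasis S e
  let E := (Algebra.TensorProduct.basis S B).equiv B' (Equiv.refl _)
  have hB : ∀ p, freeExtend R S e N (B p) = B' p := by
    classical
    rintro ⟨j, I⟩
    funext i
    simp only [B, B', Pi.basis_apply]
    change koszulMap _ e _ = _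
    rw [Pi.single_apply, Pi.single_apply]
    split_ifs
    · exact koszulMap_basis _ _
    · exact map_zero _
  refine IsBaseChange.of_equiv E fun w => ?_
  have h : (E.toLinearMap.restrictScalars R).comp (TensorProduct.mk R S _ 1) =
      freeExtend R S e N := by
    refine B.ext fun p => ?_
    rw [hB]
    change E (1 ⊗ₜ[R] B p) = _
    rw [← Algebra.TensorProduct.basis_apply, Module.Basis.equiv_apply]
    rfl
  exact LinearMap.congr_fun h w

theorem koszulD_ι {T : Type u} [CommRing T] (b : Fin e → T) (v : Fin e → T) :
    koszulD b (ExteriorAlgebra.ι T v) = algebraMap T _ (∑ i, v i * b i) := by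
  have h := koszulD_ι_mul b v 1
  rwa [mul_one, koszulD_one, mul_zero, sub_zero, ← Algebra.algebraMap_eq_smul_one] at h

/-- If `R → S` is flat and `R → S ⧸ (a)` is surjective, then every cycle of the extension to `S` of
a twisted module over `R` is homologous to a cycle defined over `R`: by flatness it is an
`S`-combination of cycles over `R`, and multiplication by `a i` is homotopic to zero. -/
theorem exists_cycle_of_flat [Fintype N] [Module.Flat R S] (a : Fin e → R)
    (hS : ∀ s : S, ∃ (r : R) (t : Fin e → S),
      s = algebraMap R S r + ∑ i, t i * algebraMap R S (a i))
    {c : N → N → KoszulAlgebra R e} {z : N → KoszulAlgebra S e}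
    (hz : twistedD (fun i => algebraMap R S (a i))
      (fun j => freeExtend R S e N (c j)) z = 0) :
    ∃ (z' : N → KoszulAlgebra R e) (w : N → KoszulAlgebra S e), twistedD a c z' = 0 ∧
      z = freeExtend R S e N z' + twistedD (fun i => algebraMap R S (a i))
        (fun j => freeExtend R S e N (c j)) w := by
  set b : Fin e → S := fun i => algebraMap R S (a i) with hb
  set D := twistedD a c
  set D' := twistedD b fun j => freeExtend R S e N (c j) with hD'
  have hκ : ∀ v, freeExtend R S e N (D v) = D' (freeExtend R S e N v) := fun v =>
    funext fun i => koszulMap_twistedD (algebraMap R S) a c v i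
  let E := (freeExtend_isBaseChange (R := R) (S := S) (e := e) (N := N)).equiv
  have hE : ∀ s v, E (s ⊗ₜ[R] v) = s • freeExtend R S e N v := fun s v =>
    IsBaseChange.equiv_tmul _ _ _
  have hED : ∀ y, E (D.lTensor S y) = D' (E y) := by
    intro y
    induction y using TensorProduct.induction_on with
    | zero => simp only [map_zero]
    | tmul s v => rw [LinearMap.lTensor_tmul, hE, hE, map_smul, hκ]
    | add x y hx hy => simp only [map_add, hx, hy]
  obtain ⟨y, rfl⟩ := E.surjective z
  have hy : D.lTensor S y = 0 := by
    rw [← hED] at hz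
    exact E.injective (hz.trans (map_zero E).symm)
  have hex := Module.Flat.lTensor_exact S (LinearMap.exact_subtype_ker_map D)
  obtain ⟨u, rfl⟩ := (hex y).1 hy
  clear hy hz
  induction u using TensorProduct.induction_on with
  | zero => exact ⟨0, 0, map_zero _, by simp only [map_zero, add_zero]⟩
  | add x y hx hy =>
    obtain ⟨z₁, w₁, h₁, h₁'⟩ := hx
    obtain ⟨z₂, w₂, h₂, h₂'⟩ := hy
    refine ⟨z₁ + z₂, w₁ + w₂, by rw [map_add, h₁, h₂, add_zero], ?_⟩
    rw [map_add, map_add, h₁', h₂', map_add, map_add]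
    abel
  | tmul s v =>
    obtain ⟨v, hv⟩ := v
    obtain ⟨r, t, rfl⟩ := hS s
    have hv : D v = 0 := hv
    -- multiplication by the `i`-th generator is a null homotopy for multiplication by `a i`
    have hom : ∀ i : Fin e,
        D' (ExteriorAlgebra.ι S (Pi.single i 1 : Fin e → S) • freeExtend R S e N v) =
          b i • freeExtend R S e N v := by
      intro i
      rw [hD', twistedD_smul, ← hD', ← hκ, hv, map_zero, smul_zero, add_zero, koszulD_ι,
        algebraMap_smul]
      congr 1
      simp [Pi.single_apply]
    refine ⟨r • v,
      ∑ i, t i • ExteriorAlgebra.ι S (Pi.single i 1 : Fin e → S) • freeExtend R S e N v,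
      by rw [map_smul, hv, smul_zero], ?_⟩
    rw [LinearMap.lTensor_tmul, hE, add_smul, map_smul, algebraMap_smul, map_sum, Finset.sum_smul]
    simp only [map_smul, hom, mul_smul]
    rfl

end FlatExtension

/-! ### Descent of the differential along a co-complete sequence -/

/-- If the sequence `a` is co-complete, then `R → R̂ ⧸ (a)` is surjective. -/
theorem IsCoComplete.exists_eq_add_sum {R : Type u} [CommRing R] [IsLocalRing R]
    [IsNoetherianRing R] {e : ℕ} {a : Fin e → R} (ha : IsCoComplete a) (s : LocalCompletion R) :
    ∃ (r : R) (t : Fin e → LocalCompletion R),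
      s = algebraMap R _ r + ∑ i, t i * algebraMap R _ (a i) := by
  set 𝔪 := IsLocalRing.maximalIdeal R
  let I := Ideal.span (Set.range a)
  let f : I →ₗ[R] R := I.subtype
  let g : R →ₗ[R] R ⧸ I := I.mkQ
  have hfg : Function.Exact f g := by
    rw [LinearMap.exact_iff, Submodule.ker_mkQ, Submodule.range_subtype]
  have : IsPrecomplete 𝔪 (R ⧸ I) :=
    (IsPrecomplete.map_algebraMap_iff (I := 𝔪) (S := R ⧸ I) (M := R ⧸ I)).1 ha.2.toIsPrecomplete
  obtain ⟨q, hq⟩ := AdicCompletion.of_surjective 𝔪 (R ⧸ I) (AdicCompletion.map 𝔪 g s)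
  obtain ⟨r, rfl⟩ := I.mkQ_surjective q
  have hker : AdicCompletion.map 𝔪 g (s - algebraMap R _ r) = 0 := by
    rw [map_sub, sub_eq_zero, ← hq]
    exact (AdicCompletion.map_of 𝔪 g r).symm
  obtain ⟨y, hy⟩ :=
    (AdicCompletion.map_exact (I := 𝔪) I.subtype_injective hfg I.mkQ_surjective _).1 hker
  suffices h : ∃ t : Fin e → LocalCompletion R,
      AdicCompletion.map 𝔪 f y = ∑ i, t i * algebraMap R _ (a i) by
    obtain ⟨t, ht⟩ := h
    exact ⟨r, t, by rw [← ht, hy]; ring⟩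
  -- the completion of the finitely generated ideal `I` is generated by `I`
  obtain ⟨u, rfl⟩ := AdicCompletion.ofTensorProduct_surjective_of_finite 𝔪 I y
  clear hy
  induction u using TensorProduct.induction_on with
  | zero => exact ⟨0, by simp⟩
  | add x y hx hy =>
    obtain ⟨t, ht⟩ := hx
    obtain ⟨t', ht'⟩ := hy
    refine ⟨t + t', ?_⟩
    rw [map_add, map_add, ht, ht', ← Finset.sum_add_distrib]
    simp only [Pi.add_apply, add_mul]
  | tmul s v =>
    obtain ⟨v, hv⟩ := v
    obtain ⟨k, rfl⟩ := Ideal.mem_span_range_iff_exists_fun.1 hv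
    refine ⟨fun i => s * algebraMap R _ (k i), ?_⟩
    rw [AdicCompletion.ofTensorProduct_tmul, map_smul, AdicCompletion.map_of]
    have h : AdicCompletion.of 𝔪 R (∑ i, k i * a i) =
        ∑ i, algebraMap R (AdicCompletion 𝔪 R) (k i) * algebraMap R _ (a i) := by
      simp only [← map_mul, ← map_sum]
      rfl
    change s • AdicCompletion.of 𝔪 R (∑ i, k i * a i) = _
    rw [h, smul_eq_mul, Finset.mul_sum]
    simp only [mul_assoc]
    rfl

theorem freeProj_freeExtend {R S : Type u} [CommRing R] [CommRing S] [Algebra R S] {e : ℕ}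
    {N : Type*} (deg : N → ℤ) (n : ℤ) (w : N → KoszulAlgebra R e) :
    freeProj S e deg n (freeExtend R S e N w) = freeExtend R S e N (freeProj R e deg n w) :=
  funext fun _ => (koszulMap_proj _ _ _).symm

section Descent

variable {R S : Type u} [CommRing R] [CommRing S] [Algebra R S] {e : ℕ} {N : Type*} [Fintype N]
  [DecidableEq N]

/-- `X` is the matrix of the differential of a complex of free modules over an `R`-algebra `T`, with
basis vectors of degrees `deg`, and `φ` consists of the rows of a homogeneous unitriangular matrix
over the Koszul algebra of `T` that defines a morphism from the Koszul extension of that complex to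
the extension to `T` of the twisted module given by `c`. -/
structure IsKoszulModel {T : Type u} [CommRing T] [Algebra R T] (a : Fin e → R) (deg : N → ℤ)
    (c : N → N → KoszulAlgebra R e) (X : N → N → T) (φ : N → N → KoszulAlgebra T e) : Prop where
  eq_zero : ∀ i j, deg i + 1 ≠ deg j → X i j = 0
  sq_eq_zero : ∀ i j, ∑ k, X i k * X k j = 0
  proj_eq : ∀ j, freeProj T e deg (deg j) (φ j) = φ j
  unitriangular : ∀ j i, ¬ deg i < deg j → φ j i = if i = j then 1 else 0
  comm : ∀ j, twistedD (fun i => algebraMap R T (a i)) (fun j => freeExtend R T e N (c j)) (φ j) =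
    ∑ i, X i j • φ i

/-- The Koszul extension of a complex of free modules over `S` is isomorphic to the extension to
`S` of a twisted module over `R`.  The differential of the latter is built degree by degree: the
boundary of a new basis vector is a cycle, so it can be moved into `R` by adding a boundary,
that is, by changing the basis vector. -/
theorem exists_isKoszulModel [Module.Flat R S] (a : Fin e → R)
    (hS : ∀ s : S, ∃ (r : R) (t : Fin e → S),
      s = algebraMap R S r + ∑ i, t i * algebraMap R S (a i))
    (deg : N → ℤ) (hdeg : ∀ i, 0 ≤ deg i) (X : N → N → S)
    (hX : ∀ i j, deg i + 1 ≠ deg j → X i j = 0) (hXX : ∀ i j, ∑ k, X i k * X k j = 0) :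
    ∃ (c : N → N → KoszulAlgebra R e) (φ : N → N → KoszulAlgebra S e),
      IsKoszulModel a deg c X φ := by
  set b : Fin e → S := fun i => algebraMap R S (a i) with hb
  suffices h : ∀ n : ℕ, ∃ (c : N → N → KoszulAlgebra R e) (φ : N → N → KoszulAlgebra S e),
      (∀ j, (n : ℤ) ≤ deg j → c j = 0) ∧
      (∀ j, freeProj R e deg (deg j - 1) (c j) = c j) ∧
      (∀ j, twistedD a c (c j) = 0) ∧
      (∀ j, freeProj S e deg (deg j) (φ j) = φ j) ∧
      (∀ j i, ¬ deg i < deg j → φ j i = if i = j then 1 else 0) ∧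
      ∀ j, deg j < n →
        twistedD b (fun j => freeExtend R S e N (c j)) (φ j) = ∑ i, X i j • φ i by
    obtain ⟨c, φ, -, -, -, h4, h5, h6⟩ := h (∑ i, (deg i).toNat + 1)
    refine ⟨c, φ, hX, hXX, h4, h5, fun j => h6 j ?_⟩
    have h : (deg j).toNat ≤ ∑ i, (deg i).toNat :=
      Finset.single_le_sum (f := fun i => (deg i).toNat) (fun _ _ => Nat.zero_le _)
        (Finset.mem_univ j)
    have := hdeg j
    omega
  intro n
  induction n with
  | zero =>
    refine ⟨0, fun j => Pi.single j 1, fun _ _ => rfl, fun _ => map_zero _, fun _ => map_zero _,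
      fun j => funext fun i => ?_, fun j i _ => Pi.single_apply _ _ _, fun j hj => ?_⟩
    · rw [freeProj_apply]
      simp only [Pi.single_apply]
      split_ifs with h
      · rw [h, sub_self, koszulProj_one]
      · rw [map_zero]
    · have := hdeg j
      simp only [Nat.cast_zero] at hj
      omega
  | succ n ih =>
    obtain ⟨c, φ, h1, h2, h3, h4, h5, h6⟩ := ih
    set c' := fun j => freeExtend R S e N (c j) with hc'
    have h1' : ∀ j, (n : ℤ) ≤ deg j → c' j = 0 := fun j hj => by
      simp only [hc', h1 j hj, map_zero]
    have h2' : ∀ j, freeProj S e deg (deg j - 1) (c' j) = c' j := fun j => by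
      rw [hc', freeProj_freeExtend, h2]
    have key : ∀ j, deg j = n → ∃ (z : N → KoszulAlgebra R e) (w : N → KoszulAlgebra S e),
        freeProj R e deg (n - 1) z = z ∧ twistedD a c z = 0 ∧ freeProj S e deg n w = w ∧
        (∀ i, (n : ℤ) ≤ deg i → w i = 0) ∧
        ∑ i, X i j • φ i = freeExtend R S e N z + twistedD b c' w := by
      intro j hj
      have hcyc : twistedD b c' (∑ i, X i j • φ i) = 0 := by
        have h : ∀ i, X i j • twistedD b c' (φ i) = ∑ k, (X k i * X i j) • φ k := by
          intro i
          by_cases hi : deg i + 1 = deg j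
          · rw [h6 i (by omega), Finset.smul_sum]
            exact Finset.sum_congr rfl fun k _ => by rw [smul_smul, mul_comm]
          · simp [hX i j hi]
        simp only [map_sum, map_smul, h]
        rw [Finset.sum_comm]
        simp only [← Finset.sum_smul, hXX, zero_smul, Finset.sum_const_zero]
      have hhom : freeProj S e deg (n - 1) (∑ i, X i j • φ i) = ∑ i, X i j • φ i := by
        rw [map_sum]
        refine Finset.sum_congr rfl fun i _ => ?_
        by_cases hi : deg i + 1 = deg j
        · rw [map_smul, show (n : ℤ) - 1 = deg i by omega, h4]
        · rw [hX i j hi, zero_smul, map_zero]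
      obtain ⟨z, w, hz, hzw⟩ := exists_cycle_of_flat a hS hcyc
      let w' : N → KoszulAlgebra S e := fun i => if deg i < n then freeProj S e deg n w i else 0
      -- the discarded part of `w` has coefficients of degree `0`, so it is a cycle
      have hw' : twistedD b c' w' = twistedD b c' (freeProj S e deg n w) := by
        rw [twistedD_apply, twistedD_apply]
        congr 1
        · funext i
          simp only [w']
          split_ifs with hi
          · rfl
          · rw [map_zero]
            refine (koszulD_of_proj (z := n - deg i) (by omega) ?_).symm
            rw [freeProj_apply, koszulProj_proj]
        · refine Finset.sum_congr rfl fun i _ => ?_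
          simp only [w']
          split_ifs with hi
          · rfl
          · rw [h1' i (by omega), smul_zero, smul_zero]
      refine ⟨freeProj R e deg (n - 1) z, w', freeProj_proj _ _ _, ?_, ?_, ?_, ?_⟩
      · rw [← freeProj_twistedD a deg _ h2, hz, map_zero]
      · funext i
        rw [freeProj_apply]
        simp only [w']
        split_ifs
        · exact koszulProj_proj _ _
        · exact map_zero _
      · intro i hi
        exact if_neg (by omega)
      · rw [hw', ← freeProj_freeExtend, ← freeProj_twistedD b deg _ h2', ← map_add, ← hzw, hhom]
    choose! z w hz hzc hw hw0 hzw using key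
    -- in degree `n`, the boundary `z j` replaces `∑ i, X i j • φ i`, and the basis vector is corrected
    -- by `w j`, which involves only basis vectors of smaller degree
    let C : N → N → KoszulAlgebra R e := fun j => if deg j = n then z j else c j
    let Φ : N → N → KoszulAlgebra S e := fun j => if deg j = n then Pi.single j 1 + w j else φ j
    have hC : ∀ j, deg j ≠ n → C j = c j := fun j hj => if_neg hj
    have hCn : ∀ j, deg j = n → C j = z j := fun j hj => if_pos hj
    have hΦ : ∀ j, deg j ≠ n → Φ j = φ j := fun j hj => if_neg hj
    have hΦn : ∀ j, deg j = n → Φ j = Pi.single j 1 + w j := fun j hj => if_pos hj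
    have hD : ∀ v : N → KoszulAlgebra R e, (∀ j, (n : ℤ) ≤ deg j → v j = 0) →
        twistedD a C v = twistedD a c v := fun v hv => twistedD_congr a fun j =>
      (lt_or_ge (deg j) n).symm.imp (hv j) fun hj => hC j hj.ne
    have hD' : ∀ v : N → KoszulAlgebra S e, (∀ j, (n : ℤ) ≤ deg j → v j = 0) →
        twistedD b (fun j => freeExtend R S e N (C j)) v = twistedD b c' v :=
      fun v hv => twistedD_congr b fun j =>
        (lt_or_ge (deg j) n).symm.imp (hv j) fun hj => by rw [hC j hj.ne]
    have hsum : ∀ j, deg j ≤ n → ∑ i, X i j • Φ i = ∑ i, X i j • φ i := by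
      intro j hj
      refine Finset.sum_congr rfl fun i _ => ?_
      by_cases hi : deg i + 1 = deg j
      · rw [hΦ i (by omega)]
      · rw [hX i j hi, zero_smul, zero_smul]
    refine ⟨C, Φ, fun j hj => ?_, fun j => ?_, fun j => ?_, fun j => ?_, fun j i hij => ?_,
      fun j hj => ?_⟩
    · push_cast at hj
      rw [hC j (by omega), h1 j (by omega)]
    · by_cases hj : deg j = n
      · rw [hCn j hj, hj, hz j hj]
      · rw [hC j hj, h2]
    · by_cases hj : deg j = n
      · rw [hCn j hj, hD _ fun i hi => apply_eq_zero_of_freeProj (hz j hj) (by omega), hzc j hj]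
      · rw [hC j hj]
        rcases lt_or_ge (deg j) n with hjn | hjn
        · rw [hD _ fun i hi => apply_eq_zero_of_freeProj (h2 j) (by omega), h3]
        · rw [h1 j hjn, map_zero]
    · by_cases hj : deg j = n
      · rw [hΦn j hj, map_add, hj, hw j hj]
        congr 1
        funext i
        rw [freeProj_apply, Pi.single_apply]
        split_ifs with h
        · rw [h, hj, sub_self, koszulProj_one]
        · rw [map_zero]
      · rw [hΦ j hj, h4]
    · by_cases hj : deg j = n
      · rw [hΦn j hj, Pi.add_apply, hw0 j hj i (by omega), add_zero, Pi.single_apply]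
      · rw [hΦ j hj, h5 j i hij]
    · by_cases hjn : deg j = n
      · rw [hsum j hjn.le, hzw j hjn, hΦn j hjn, map_add, hD' _ (hw0 j hjn)]
        congr 1
        rw [twistedD_apply, Finset.sum_eq_single j]
        · have h : (fun i => koszulD b ((Pi.single j 1 : N → KoszulAlgebra S e) i)) = 0 := by
            funext i
            rw [Pi.single_apply]
            split_ifs
            · exact koszulD_one b
            · exact map_zero _
          have h' : koszulSign S e 1 = 1 := map_one (CliffordAlgebra.involute)
          rw [h, zero_add, Pi.single_eq_same, h', one_smul, hCn j hjn]
        · intro i _ hi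
          rw [Pi.single_eq_of_ne hi, map_zero, zero_smul]
        · simp
      · push_cast at hj
        rw [hsum j (by omega), ← h6 j (by omega), hΦ j hjn, hD']
        intro i hi
        exact apply_eq_zero_of_freeProj (h4 j) (by omega)

/-! ### The polynomial system -/

/-- An element of the Koszul algebra vanishes after a change of rings if and only if its coordinates
do; this turns equations in the Koszul algebra into polynomial equations. -/
theorem koszulBasis_repr_map_eq_zero {T T' : Type u} [CommRing T] [CommRing T'] (g : T →+* T')
    (x : KoszulAlgebra T e) :
    (∀ I, g ((koszulBasis T e).repr x I) = 0) ↔ koszulMap g e x = 0 := by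
  simp only [← koszulBasis_repr_map]
  rw [← (koszulBasis T' e).repr.map_eq_zero_iff]
  exact (DFunLike.ext_iff (f := (koszulBasis T' e).repr (koszulMap g e x)) (g := 0)).symm

/-- A solution over `R` is also a solution over every `R`-algebra. -/
theorem IsKoszulModel.baseChange {a : Fin e → R} {deg : N → ℤ} {c : N → N → KoszulAlgebra R e}
    {X : N → N → R} {φ : N → N → KoszulAlgebra R e} (h : IsKoszulModel a deg c X φ) :
    IsKoszulModel a deg c (fun i j => algebraMap R S (X i j))
      (fun j => freeExtend R S e N (φ j)) where
  eq_zero i j hij := by rw [h.eq_zero i j hij, map_zero]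
  sq_eq_zero i j := by simp only [← map_mul, ← map_sum, h.sq_eq_zero, map_zero]
  proj_eq j := by rw [freeProj_freeExtend, h.proj_eq]
  unitriangular j i hij := by
    change koszulMap _ e (φ j i) = _
    rw [h.unitriangular j i hij]
    split_ifs
    · exact map_one _
    · exact map_zero _
  comm j := by
    have h' := congrArg (freeExtend R S e N) (h.comm j)
    rw [map_sum] at h'
    simp only [map_smul, ← algebraMap_smul S (X _ _) (freeExtend R S e N _)] at h'
    rw [← h']
    refine funext fun i => .trans ?_ (koszulMap_twistedD _ _ _ _ i).symm
    congr! 4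
    simp only [freeExtend, LinearMap.coe_mk, AddHom.coe_mk, koszulMap_comp]
    rfl

/-- For a fixed twisted module over `R`, the pairs `(X, φ)` satisfying `IsKoszulModel` are the
solutions of a system of polynomial equations: the unknowns are the entries of `X` and the
coordinates of the entries of `φ` in the standard basis of the Koszul algebra, and the equations
are read off from the conditions for the generic pair, over the polynomial ring. -/
theorem exists_system (a : Fin e → R) (deg : N → ℤ) (c : N → N → KoszulAlgebra R e) :
    ∃ (k : ℕ) (𝒮 : Finset (MvPolynomial (Fin k) R)),
      ∀ (T : Type u) [CommRing T] [Algebra R T],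
        (∃ x : Fin k → T, IsSolution 𝒮 x) ↔
          ∃ (X : N → N → T) (φ : N → N → KoszulAlgebra T e), IsKoszulModel a deg c X φ := by
  classical
  let V := (N × N) ⊕ (N × N × Finset (Fin e))
  let ν : V ≃ Fin (Fintype.card V) := Fintype.equivFin V
  let T₀ := MvPolynomial (Fin (Fintype.card V)) R
  let X₀ : N → N → T₀ := fun i j => MvPolynomial.X (ν (.inl (i, j)))
  let φ₀ : N → N → KoszulAlgebra T₀ e := fun j i =>
    ∑ I, (MvPolynomial.X (ν (.inr (j, i, I))) : T₀) • koszulBasis T₀ e I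
  -- the conditions on the generic pair, as elements of the polynomial ring and its Koszul algebra
  let p₁ : N × N → T₀ := fun q => if deg q.1 + 1 ≠ deg q.2 then X₀ q.1 q.2 else 0
  let p₂ : N × N → T₀ := fun q => ∑ k, X₀ q.1 k * X₀ k q.2
  let y₁ : N × N → KoszulAlgebra T₀ e := fun q =>
    freeProj T₀ e deg (deg q.1) (φ₀ q.1) q.2 - φ₀ q.1 q.2
  let y₂ : N × N → KoszulAlgebra T₀ e := fun q =>
    if ¬ deg q.2 < deg q.1 then φ₀ q.1 q.2 - (if q.2 = q.1 then 1 else 0) else 0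
  let y₃ : N × N → KoszulAlgebra T₀ e := fun q =>
    twistedD (fun i => algebraMap R T₀ (a i)) (fun j => freeExtend R T₀ e N (c j)) (φ₀ q.1) q.2 -
      ∑ i, X₀ i q.1 • φ₀ i q.2
  let coords : (N × N → KoszulAlgebra T₀ e) → Finset T₀ := fun y =>
    Finset.univ.image fun q : (N × N) × Finset (Fin e) => (koszulBasis T₀ e).repr (y q.1) q.2
  refine ⟨_, Finset.univ.image p₁ ∪ (Finset.univ.image p₂ ∪
    (coords y₁ ∪ (coords y₂ ∪ coords y₃))), fun T _ _ => ?_⟩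
  have key : ∀ x : Fin (Fintype.card V) → T,
      IsSolution (Finset.univ.image p₁ ∪ (Finset.univ.image p₂ ∪
        (coords y₁ ∪ (coords y₂ ∪ coords y₃)))) x ↔
      IsKoszulModel a deg c (fun i j => x (ν (.inl (i, j))))
        (fun j i => ∑ I, x (ν (.inr (j, i, I))) • koszulBasis T e I) := by
    intro x
    let g : T₀ →+* T := (MvPolynomial.aeval x : T₀ →ₐ[R] T).toRingHom
    have hgX : ∀ v, g (MvPolynomial.X v) = x v := fun v => MvPolynomial.aeval_X x v
    have hgR : g.comp (algebraMap R T₀) = algebraMap R T := (MvPolynomial.aeval x).comp_algebraMap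
    have hgR' : ∀ r, g (algebraMap R T₀ r) = algebraMap R T r := fun r => RingHom.congr_fun hgR r
    set X : N → N → T := fun i j => x (ν (.inl (i, j))) with hX
    set φ : N → N → KoszulAlgebra T e :=
      fun j i => ∑ I, x (ν (.inr (j, i, I))) • koszulBasis T e I with hφ
    have hgX₀ : ∀ i j, g (X₀ i j) = X i j := fun i j => hgX _
    have hgφ₀ : ∀ j i, koszulMap g e (φ₀ j i) = φ j i := fun j i => by
      simp only [φ₀, map_sum, koszulMap_smul, koszulMap_basis, hgX, hφ]
    have hcoords : ∀ y, (∀ p ∈ coords y, g p = 0) ↔ ∀ j i, koszulMap g e (y (j, i)) = 0 := by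
      intro y
      simp only [coords, Finset.forall_mem_image, Finset.mem_univ, true_implies, Prod.forall,
        koszulBasis_repr_map_eq_zero]
    have hsol : IsSolution (Finset.univ.image p₁ ∪ (Finset.univ.image p₂ ∪
        (coords y₁ ∪ (coords y₂ ∪ coords y₃)))) x ↔
        (∀ i j, g (p₁ (i, j)) = 0) ∧ (∀ i j, g (p₂ (i, j)) = 0) ∧
        (∀ j i, koszulMap g e (y₁ (j, i)) = 0) ∧ (∀ j i, koszulMap g e (y₂ (j, i)) = 0) ∧
        ∀ j i, koszulMap g e (y₃ (j, i)) = 0 := by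
      rw [← hcoords, ← hcoords, ← hcoords]
      unfold IsSolution
      change (∀ p ∈ _, g p = 0) ↔ _
      simp only [Finset.forall_mem_union, Finset.forall_mem_image, Finset.mem_univ, true_implies,
        Prod.forall]
    have h₁ : ∀ i j, g (p₁ (i, j)) = 0 ↔ (deg i + 1 ≠ deg j → X i j = 0) := fun i j => by
      simp only [p₁]
      split_ifs with h <;> simp [h, hgX₀]
    have h₂ : ∀ i j, g (p₂ (i, j)) = ∑ k, X i k * X k j := fun i j => by
      simp only [p₂, map_sum, map_mul, hgX₀]
    have h₃ : ∀ j i, koszulMap g e (y₁ (j, i)) = freeProj T e deg (deg j) (φ j) i - φ j i :=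
      fun j i => by simp only [y₁, map_sub, freeProj_apply, koszulMap_proj, hgφ₀]
    have h₄ : ∀ j i, koszulMap g e (y₂ (j, i)) = 0 ↔
        (¬ deg i < deg j → φ j i = if i = j then 1 else 0) := fun j i => by
      simp only [y₂]
      split_ifs with h h' <;> simp [h, hgφ₀, sub_eq_zero]
    have h₅ : ∀ j i, koszulMap g e (y₃ (j, i)) =
        twistedD (fun i => algebraMap R T (a i)) (fun j => freeExtend R T e N (c j)) (φ j) i -
          ∑ i', X i' j • φ i' i := fun j i => by
      simp only [y₃, map_sub, map_sum, koszulMap_smul, hgφ₀, hgX₀, koszulMap_twistedD, hgR']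
      congr! 4
      simp only [freeExtend, LinearMap.coe_mk, AddHom.coe_mk, koszulMap_comp, hgR]
    simp only [hsol, h₁, h₂, h₃, h₄, h₅, sub_eq_zero]
    constructor
    · rintro ⟨H₁, H₂, H₃, H₄, H₅⟩
      exact ⟨H₁, H₂, fun j => funext (H₃ j), H₄, fun j => funext fun i => by
        rw [H₅]; simp only [Finset.sum_apply, Pi.smul_apply]⟩
    · rintro ⟨H₁, H₂, H₃, H₄, H₅⟩
      exact ⟨H₁, H₂, fun j => congrFun (H₃ j), H₄, fun j i => by
        rw [H₅]; simp only [Finset.sum_apply, Pi.smul_apply]⟩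
  constructor
  · rintro ⟨x, hx⟩
    exact ⟨_, _, (key x).1 hx⟩
  · rintro ⟨X, φ, h⟩
    refine ⟨fun v => Sum.elim (fun q : N × N => X q.1 q.2)
      (fun q : N × N × Finset (Fin e) => (koszulBasis T e).repr (φ q.1 q.2.1) q.2.2) (ν.symm v),
      (key _).2 ?_⟩
    simpa only [Equiv.symm_apply_apply, Sum.elim_inl, Sum.elim_inr, Module.Basis.sum_repr] using h

end Descent

/-! ### Coordinates on the Koszul extension of a complex of free modules -/

namespace KoszulDGModule

variable {S : Type u} [CommRing S] {e : ℕ} {b : Fin e → S}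

theorem quasiIso_of_bijective {M N : KoszulDGModule b} (f : M ⟶ N)
    (hf : Function.Bijective f.toLin) : quasiIso b f := by
  constructor
  · rw [← LinearMap.ker_eq_bot, LinearMap.ker_eq_bot']
    intro x hx
    obtain ⟨⟨y, hy⟩, rfl⟩ := Submodule.Quotient.mk_surjective _ x
    obtain ⟨z, hz⟩ := (Submodule.Quotient.mk_eq_zero _).1 hx
    obtain ⟨w, rfl⟩ := hf.2 z
    refine (Submodule.Quotient.mk_eq_zero _).2 ⟨w, hf.1 ?_⟩
    rw [f.map_d]
    exact hz
  · intro x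
    obtain ⟨⟨y, hy⟩, rfl⟩ := Submodule.Quotient.mk_surjective _ x
    obtain ⟨z, rfl⟩ := hf.2 y
    refine ⟨Submodule.Quotient.mk ⟨z, hf.1 ?_⟩, rfl⟩
    rw [f.map_d, map_zero]
    exact hy

end KoszulDGModule

section Coordinates

variable {T S : Type u} [CommRing T] [CommRing S] [Algebra T S] {e : ℕ}
  {M : ChainComplex (ModuleCat.{u} T) ℤ} {r : ℤ → ℕ}

/-- The basis of the total module of a complex formed by bases of its components. -/
noncomputable def totalBasis (β : ∀ n, Module.Basis (Fin (r n)) T (M.X n)) :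
    Module.Basis (Σ n, Fin (r n)) T (totalModule M) :=
  DFinsupp.basis β

theorem totalBasis_repr_apply (β : ∀ n, Module.Basis (Fin (r n)) T (M.X n)) (y : totalModule M)
    (i : Σ n, Fin (r n)) : (totalBasis β).repr y i = (β i.1).repr (y i.1) i.2 := rfl

theorem totalBasis_apply (β : ∀ n, Module.Basis (Fin (r n)) T (M.X n)) (i : Σ n, Fin (r n)) :
    totalBasis β i = DirectSum.lof T ℤ (fun n => M.X n) i.1 (β i.1 i.2) := by
  classical
  refine (totalBasis β).ext_elem fun k => ?_
  obtain ⟨n, p⟩ := i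
  obtain ⟨n', p'⟩ := k
  rw [Module.Basis.repr_self, totalBasis_repr_apply]
  by_cases h : n' = n
  · subst h
    rw [DirectSum.lof_apply, Module.Basis.repr_self, Finsupp.single_apply, Finsupp.single_apply]
    simp
  · rw [DirectSum.lof_eq_of, DirectSum.of_eq_of_ne _ _ _ h, map_zero, Finsupp.single_eq_of_ne]
    · rfl
    · exact fun h' => h (congrArg Sigma.fst h')

/-- The differential of a complex of free modules has degree `-1`. -/
theorem totalBasis_repr_totalD_eq_zero (β : ∀ n, Module.Basis (Fin (r n)) T (M.X n))
    (i j : Σ n, Fin (r n)) (h : i.1 + 1 ≠ j.1) :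
    (totalBasis β).repr (totalD M (totalBasis β j)) i = 0 := by
  rw [totalBasis_apply, totalD_lof, totalBasis_repr_apply, DirectSum.lof_eq_of,
    DirectSum.of_eq_of_ne _ _ _ (by omega), map_zero]
  rfl

variable [Fintype (Σ n, Fin (r n))]

/-- The coordinates on the Koszul extension of a complex of free modules. -/
noncomputable def koszulCoords (S : Type u) [CommRing S] [Algebra T S] (e : ℕ)
    (β : ∀ n, Module.Basis (Fin (r n)) T (M.X n)) :
    (KoszulAlgebra S e ⊗[T] totalModule M) ≃ₗ[KoszulAlgebra S e]
      ((Σ n, Fin (r n)) → KoszulAlgebra S e) :=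
  (Algebra.TensorProduct.basis (KoszulAlgebra S e) (totalBasis β)).equivFun

theorem koszulCoords_tmul (β : ∀ n, Module.Basis (Fin (r n)) T (M.X n)) (x : KoszulAlgebra S e)
    (y : totalModule M) (i : Σ n, Fin (r n)) :
    koszulCoords S e β (x ⊗ₜ[T] y) i =
      algebraMap T S ((totalBasis β).repr y i) • x := by
  rw [koszulCoords, Module.Basis.equivFun_apply, Algebra.TensorProduct.basis_repr_tmul]
  simp only [Finsupp.smul_apply, Finsupp.mapRange_apply, smul_eq_mul]
  rw [← Algebra.commutes, ← Algebra.smul_def, algebraMap_smul]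

theorem koszulCoords_symm_apply (β : ∀ n, Module.Basis (Fin (r n)) T (M.X n))
    (w : (Σ n, Fin (r n)) → KoszulAlgebra S e) :
    (koszulCoords S e β).symm w = ∑ i, w i ⊗ₜ[T] totalBasis β i := by
  rw [koszulCoords, Module.Basis.equivFun_symm_apply]
  simp only [Algebra.TensorProduct.basis_apply, TensorProduct.smul_tmul', smul_eq_mul, mul_one]

theorem koszulCoords_d (β : ∀ n, Module.Basis (Fin (r n)) T (M.X n)) (b : Fin e → S)
    (t : KoszulAlgebra S e ⊗[T] totalModule M) :
    koszulCoords S e β (koszulTensorD b M t) =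
      twistedD b (fun j i => algebraMap S _ (algebraMap T S
        ((totalBasis β).repr (totalD M (totalBasis β j)) i))) (koszulCoords S e β t) := by
  induction t using TensorProduct.induction_on with
  | zero => simp only [map_zero]
  | add x y hx hy => simp only [map_add, hx, hy]
  | tmul x y =>
    funext i
    have h : (totalBasis β).repr (totalD M y) i =
        ∑ j, (totalBasis β).repr y j * (totalBasis β).repr (totalD M (totalBasis β j)) i := by
      conv_lhs => rw [← (totalBasis β).sum_repr y]
      simp only [map_sum, map_smul, Finsupp.coe_finsetSum, Finset.sum_apply, Finsupp.smul_apply,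
        smul_eq_mul]
    rw [koszulTensorD_tmul, map_add, Pi.add_apply, koszulCoords_tmul, koszulCoords_tmul,
      twistedD_apply, Pi.add_apply, Finset.sum_apply, h]
    simp only [koszulCoords_tmul, map_smul, Pi.smul_apply, smul_eq_mul, map_sum, Finset.sum_smul]
    congr 1
    refine Finset.sum_congr rfl fun j _ => ?_
    rw [← Algebra.commutes, ← Algebra.smul_def, smul_smul, mul_comm, map_mul]

theorem mem_koszulTensorDeg_iff (β : ∀ n, Module.Basis (Fin (r n)) T (M.X n)) (n : ℤ)
    (t : KoszulAlgebra S e ⊗[T] totalModule M) :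
    t ∈ koszulTensorDeg S e M n ↔
      freeProj S e Sigma.fst n (koszulCoords S e β t) = koszulCoords S e β t := by
  constructor
  · intro ht
    induction ht using Submodule.span_induction with
    | zero => simp only [map_zero]
    | add x y _ _ hx hy => simp only [map_add, hx, hy]
    | smul s x _ hx =>
      have h : koszulCoords S e β (s • x) = s • koszulCoords S e β x :=
        ((koszulCoords S e β).toLinearMap.restrictScalars S).map_smul s x
      rw [h, map_smul, hx]
    | mem t ht =>
      obtain ⟨i, j, x, y, hx, rfl, rfl⟩ := ht
      funext k
      rw [freeProj_apply, koszulCoords_tmul, totalBasis_repr_apply, map_smul, koszulProj_of_mem hx]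
      by_cases hk : k.1 = j
      · rw [if_pos (by omega)]
      · rw [DirectSum.lof_eq_of, DirectSum.of_eq_of_ne _ _ _ hk]
        simp
  · intro h
    rw [← (koszulCoords S e β).symm_apply_apply t, koszulCoords_symm_apply]
    refine Submodule.sum_mem _ fun i _ => ?_
    rw [← h, freeProj_apply, totalBasis_apply]
    rcases lt_or_ge (n - i.1) 0 with hi | hi
    · rw [koszulProj_of_neg hi, TensorProduct.zero_tmul]
      exact Submodule.zero_mem _
    · obtain ⟨z, hz⟩ := Int.eq_ofNat_of_zero_le hi
      rw [hz]
      exact koszulTensorDeg_tmul_mem M (koszulProj_mem z _) _ (by omega)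

/-- A homogeneous unitriangular matrix over the Koszul algebra that commutes with the differentials
identifies the Koszul extension of a complex of free modules with a twisted module. -/
theorem exists_linearEquiv_twisted [DecidableEq (Σ n, Fin (r n))]
    (hr : ∀ i : Σ n, Fin (r n), 0 ≤ i.1)
    (β : ∀ n, Module.Basis (Fin (r n)) T (M.X n)) (b : Fin e → S)
    {c φ : (Σ n, Fin (r n)) → (Σ n, Fin (r n)) → KoszulAlgebra S e}
    (hproj : ∀ j, freeProj S e Sigma.fst j.1 (φ j) = φ j)
    (htri : ∀ j i, ¬ i.1 < j.1 → φ j i = if i = j then 1 else 0)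
    (hcomm : ∀ j, twistedD b c (φ j) = ∑ i, algebraMap T S
      ((totalBasis β).repr (totalD M (totalBasis β j)) i) • φ i) :
    ∃ E : (KoszulAlgebra S e ⊗[T] totalModule M) ≃ₗ[KoszulAlgebra S e]
        ((Σ n, Fin (r n)) → KoszulAlgebra S e),
      (∀ t, E (koszulTensorD b M t) = twistedD b c (E t)) ∧
      ∀ n t, t ∈ koszulTensorDeg S e M n ↔ freeProj S e Sigma.fst n (E t) = E t := by
  have hbij := linearCombination_bijective Sigma.fst hr htri
  refine ⟨(koszulCoords S e β).trans (LinearEquiv.ofBijective _ hbij), fun t => ?_, fun n t => ?_⟩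
  · rw [LinearEquiv.trans_apply, LinearEquiv.trans_apply, LinearEquiv.ofBijective_apply,
      LinearEquiv.ofBijective_apply, koszulCoords_d, twistedD_linearCombination]
    intro j
    rw [hcomm, Fintype.linearCombination_apply]
    simp only [algebraMap_smul]
  · rw [LinearEquiv.trans_apply, LinearEquiv.ofBijective_apply, mem_koszulTensorDeg_iff β,
      freeProj_linearCombination _ _ hproj, hbij.1.eq_iff]

end Coordinates

/-! ### The complex of free modules with a given matrix -/

section MatrixComplex

variable {R : Type u} [CommRing R] {r : ℤ → ℕ} [Fintype (Σ n, Fin (r n))]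

/-- The complex with components `R ^ r n` whose differential, on the direct sum of all components,
has matrix `X`. -/
noncomputable def matrixComplex (X : (Σ n, Fin (r n)) → (Σ n, Fin (r n)) → R)
    (hX : ∀ i j, i.1 + 1 ≠ j.1 → X i j = 0) (hXX : ∀ i j, ∑ k, X i k * X k j = 0) :
    ChainComplex (ModuleCat.{u} R) ℤ where
  X n := ModuleCat.of R (Fin (r n) → R)
  d i j := ModuleCat.ofHom (Matrix.toLin' (Matrix.of fun p q => X ⟨j, p⟩ ⟨i, q⟩))
  shape i j h := by
    have h0 : (Matrix.of fun (p : Fin (r j)) (q : Fin (r i)) => X ⟨j, p⟩ ⟨i, q⟩) = 0 :=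
      Matrix.ext fun p q => hX _ _ h
    rw [h0, map_zero]
    rfl
  d_comp_d' i j k hij _ := by
    rw [← ModuleCat.ofHom_comp, ← Matrix.toLin'_mul]
    have h0 : (Matrix.of fun (p : Fin (r k)) (q : Fin (r j)) => X ⟨k, p⟩ ⟨j, q⟩) *
        (Matrix.of fun (p : Fin (r j)) (q : Fin (r i)) => X ⟨j, p⟩ ⟨i, q⟩) = 0 := by
      refine Matrix.ext fun p q => ?_
      rw [Matrix.mul_apply, Matrix.zero_apply, ← hXX ⟨k, p⟩ ⟨i, q⟩]
      refine Finset.sum_of_injOn (Sigma.mk j : _ → Σ n, Fin (r n)) sigma_mk_injective.injOn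
        (fun _ _ => by simp) ?_
        fun _ _ => rfl
      rintro ⟨l, s⟩ - hl
      by_cases h : l + 1 = i
      · have hij' : j + 1 = i := hij
        obtain rfl : l = j := by omega
        exact absurd ⟨s, by simp, rfl⟩ hl
      · rw [hX ⟨l, s⟩ ⟨i, q⟩ h, mul_zero]
    rw [h0, map_zero]
    rfl

theorem matrixComplex_repr_totalD (X : (Σ n, Fin (r n)) → (Σ n, Fin (r n)) → R)
    (hX : ∀ i j, i.1 + 1 ≠ j.1 → X i j = 0) (hXX : ∀ i j, ∑ k, X i k * X k j = 0)
    (β : ∀ n, Module.Basis (Fin (r n)) R ((matrixComplex X hX hXX).X n))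
    (hβ : ∀ n, β n = Pi.basisFun R (Fin (r n))) (i j : Σ n, Fin (r n)) :
    (totalBasis β).repr (totalD (matrixComplex X hX hXX) (totalBasis β j)) i = X i j := by
  by_cases h : i.1 + 1 = j.1
  · obtain ⟨n, p⟩ := i
    obtain ⟨n', q⟩ := j
    obtain rfl : n = n' - 1 := by simp only at h; omega
    rw [totalBasis_apply, totalD_lof, totalBasis_repr_apply, DirectSum.lof_apply, hβ, hβ]
    change Matrix.toLin' _ (Pi.basisFun R (Fin (r n')) q) p = _
    rw [Pi.basisFun_apply, Matrix.toLin'_apply, Matrix.mulVec_single_one]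
    rfl
  · rw [totalBasis_repr_totalD_eq_zero β i j h, hX i j h]

end MatrixComplex

/-! ### Comparison in the derived category -/

theorem lemma2p1 {R : Type u} [CommRing R] [IsLocalRing R] [IsNoetherianRing R]
    (m : ℕ) (hm : 0 < m)
    (P : ChainComplex (ModuleCat.{u} (LocalCompletion R)) ℤ) (hP : IsFiniteFreeComplex m P)
    {e : ℕ} (a : Fin e → R) (ha : IsCoComplete a) :
    ∃ (k : ℕ) (𝒮 : Finset (MvPolynomial (Fin k) R)),
      (∃ x : Fin k → LocalCompletion R, IsSolution 𝒮 x) ∧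
      ∀ x : Fin k → R, IsSolution 𝒮 x →
        ∃ A : ChainComplex (ModuleCat.{u} R) ℤ, IsFiniteFreeComplex m A ∧
          Nonempty
            ((KoszulDGModule.toDerived fun i => algebraMap R (LocalCompletion R) (a i)).obj
                (koszulTensor (fun i => algebraMap R (LocalCompletion R) (a i)) A) ≅
              (KoszulDGModule.toDerived fun i => algebraMap R (LocalCompletion R) (a i)).obj
                (koszulTensor (fun i => algebraMap R (LocalCompletion R) (a i)) P)) := by
  classical
  set S := LocalCompletion R
  set b : Fin e → S := fun i => algebraMap R S (a i) with hb
  have hfree : ∀ n, Module.Free S (P.X n) := fun n => (hP.1 n).1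
  have hfin : ∀ n, Module.Finite S (P.X n) := fun n => (hP.1 n).2
  let r : ℤ → ℕ := fun n => Module.finrank S (P.X n)
  have hr : ∀ n, n < 0 ∨ (m : ℤ) < n → r n = 0 := fun n hn =>
    have := hP.2 n hn
    Module.finrank_zero_of_subsingleton
  -- the nonempty index sets are those of the degrees from `0` to `m`
  have hN : ∀ i : Σ n, Fin (r n), 0 ≤ i.1 ∧ i.1 ≤ m := fun i => by
    by_contra h
    have h0 := hr i.1 (by omega)
    exact (h0 ▸ i.2.pos).false
  have : Finite (Σ n, Fin (r n)) := by
    have : Finite (Σ n : Finset.Icc (0 : ℤ) m, Fin (r n)) := inferInstance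
    exact Finite.of_injective
      (fun i => (⟨⟨i.1, Finset.mem_Icc.2 (hN i)⟩, i.2⟩ : Σ n : Finset.Icc (0 : ℤ) m, Fin (r n)))
      (fun i j h => by
        obtain ⟨i1, i2⟩ := i
        obtain ⟨j1, j2⟩ := j
        simp only [Sigma.mk.injEq, Subtype.mk.injEq] at h
        obtain ⟨rfl, h⟩ := h
        simpa using h)
  cases nonempty_fintype (Σ n, Fin (r n))
  let β : ∀ n, Module.Basis (Fin (r n)) S (P.X n) := fun n => Module.finBasis S (P.X n)
  let Y : (Σ n, Fin (r n)) → (Σ n, Fin (r n)) → S := fun i j =>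
    (totalBasis β).repr (totalD P (totalBasis β j)) i
  have hY : ∀ i j, i.1 + 1 ≠ j.1 → Y i j = 0 := totalBasis_repr_totalD_eq_zero β
  have hYY : ∀ i j, ∑ k, Y i k * Y k j = 0 := by
    intro i j
    have h : (totalBasis β).repr (totalD P (totalD P (totalBasis β j))) i = 0 := by
      rw [totalD_totalD, map_zero]; rfl
    rw [← (totalBasis β).sum_repr (totalD P (totalBasis β j))] at h
    simp only [map_sum, map_smul, Finsupp.coe_finsetSum, Finset.sum_apply, Finsupp.smul_apply,
      smul_eq_mul] at h
    rw [← h]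
    exact Finset.sum_congr rfl fun k _ => mul_comm _ _
  obtain ⟨c, φ, hφ⟩ := exists_isKoszulModel (S := S) a ha.exists_eq_add_sum Sigma.fst
    (fun i => (hN i).1) Y hY hYY
  obtain ⟨k, 𝒮, h𝒮⟩ := exists_system a Sigma.fst c
  refine ⟨k, 𝒮, (h𝒮 S).2 ⟨Y, φ, hφ⟩, fun x hx => ?_⟩
  obtain ⟨X, ψ, hψ⟩ := (h𝒮 R).1 ⟨x, hx⟩
  let A := matrixComplex X hψ.eq_zero hψ.sq_eq_zero
  refine ⟨A, ⟨fun n => ⟨?_, ?_⟩, fun n hn => ?_⟩, ?_⟩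
  · exact inferInstanceAs (Module.Free R (Fin (r n) → R))
  · exact inferInstanceAs (Module.Finite R (Fin (r n) → R))
  · have : IsEmpty (Fin (r n)) := by rw [hr n hn]; infer_instance
    exact inferInstanceAs (Subsingleton (Fin (r n) → R))
  let βA : ∀ n, Module.Basis (Fin (r n)) R (A.X n) := fun n => Pi.basisFun R (Fin (r n))
  have hψS := hψ.baseChange (S := S)
  obtain ⟨E, hEd, hE⟩ := exists_linearEquiv_twisted (fun i => (hN i).1) βA b hψS.proj_eq
    hψS.unitriangular fun j => by
      simp only [A, matrixComplex_repr_totalD X hψ.eq_zero hψ.sq_eq_zero βA fun _ => rfl]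
      exact hψS.comm j
  obtain ⟨F, hFd, hF⟩ := exists_linearEquiv_twisted (fun i => (hN i).1) β b hφ.proj_eq
    hφ.unitriangular hφ.comm
  let f : koszulTensor b A ⟶ koszulTensor b P :=
    { toLin := (E.trans F.symm).toLinearMap
      map_mem := fun {n t} ht => by
        refine (hF n _).2 ?_
        have h : F ((E.trans F.symm) t) = E t := F.apply_symm_apply _
        exact (congrArg _ h).trans (((hE n t).1 ht).trans h.symm)
      map_d := fun t => by
        refine F.injective ?_
        have h : ∀ t, F ((E.trans F.symm) t) = E t := fun t => F.apply_symm_apply _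
        exact (h _).trans ((hEd t).trans ((congrArg _ (h t).symm).trans (hFd _).symm)) }
  have hf : KoszulDGModule.quasiIso b f :=
    KoszulDGModule.quasiIso_of_bijective f (E.trans F.symm).bijective
  have := (KoszulDGModule.quasiIso b).Q_inverts f hf
  exact ⟨asIso ((KoszulDGModule.toDerived b).map f)⟩
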